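/- **Proposition 4.1.** Let $(M,g)$ be a smooth ($C^\infty$) $S^1$-invariant Riemannian manifold of area $4\pi$, diffeomorphic to $S^2$, written in momentum coordinates: off the two fixed points of the $S^1$-action, $$g=\frac{1}{f(x)}\,dx\otimes dx+f(x)\,d\theta\otimes d\theta ,\qquad (x,\theta)\in(-1,1)\times[0,2\pi),$$ where $S^1$ acts by translation of $\theta$, $M$ is identified with the unit sphere by a diffeomorphism for which $x$ is the height and $\theta$ the longitude, and $f$ is $C^\infty$ on $[-1,1]$, positive on $(-1,1)$, with $f(-1)=f(1)=0$, $f'(-1)=2$ and $f'(1)=-2$. Let $\lambda_0^1$ be the first nonzero $S^1$-invariant eigenvalue of $g$, that is, the smallest $\lambda\neq 0$ for which there is a smooth $S^1$-invariant function $u:M\to\mathbb R$, $u\not\equiv 0$, with $-\Delta_g u=\lambda u$ (such a smallest $\lambda$ exists). Then $$\lambda_0^1\le\frac32\int_{-1}^{1}f(x)\,dx .$$ Moreover, equality holds if and only if $(M,g)$ is isometric to $S^2$ with its canonical metric, and equality holds if and only if $f(x)=1-x^2$ for all $x\in[-1,1]$. -/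

import Mathlib

open Set Real
open scoped Manifold ContDiff

noncomputable section

/-- The unit sphere `S²` in Euclidean 3-space, with Mathlib's smooth structure. -/
abbrev S2 : Type := Metric.sphere (0 : EuclideanSpace ℝ (Fin 3)) 1

/-- A smooth (`C^∞`) Riemannian metric on a smooth surface `M`. -/
abbrev SurfaceMetric (M : Type*) [TopologicalSpace M] [ChartedSpace (EuclideanSpace ℝ (Fin 2)) M]
    [IsManifold (𝓡 2) ∞ M] : Type _ :=
  Bundle.ContMDiffRiemannianMetric (𝓡 2) ∞ (EuclideanSpace ℝ (Fin 2))
    (fun p : M => TangentSpace (𝓡 2) p)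

/-- The canonical metric of `S²`, induced from Euclidean 3-space by the inclusion. -/
def roundInner (p : S2) (v w : TangentSpace (𝓡 2) p) : ℝ :=
  @inner ℝ (EuclideanSpace ℝ (Fin 3)) _
    (mfderiv (𝓡 2) 𝓘(ℝ, EuclideanSpace ℝ (Fin 3))
      (fun q : S2 => (q : EuclideanSpace ℝ (Fin 3))) p v)
    (mfderiv (𝓡 2) 𝓘(ℝ, EuclideanSpace ℝ (Fin 3))
      (fun q : S2 => (q : EuclideanSpace ℝ (Fin 3))) p w)

lemma norm_cylinder_vec (c θ : ℝ) (hc : c ∈ Icc (-1 : ℝ) 1) :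
    !₂[√(1 - c ^ 2) * cos θ, √(1 - c ^ 2) * sin θ, c] ∈
      Metric.sphere (0 : EuclideanSpace ℝ (Fin 3)) 1 := by
  have h : 0 ≤ 1 - c ^ 2 := by nlinarith [hc.1, hc.2]
  have h1 : ‖!₂[√(1 - c ^ 2) * cos θ, √(1 - c ^ 2) * sin θ, c]‖ ^ 2 = 1 := by
    rw [EuclideanSpace.norm_sq_eq]
    simp only [Fin.sum_univ_three, Real.norm_eq_abs, sq_abs]
    simp only [Matrix.cons_val_zero, Matrix.cons_val_one, Matrix.cons_val]
    rw [mul_pow, mul_pow, Real.sq_sqrt h]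
    nlinarith [sin_sq_add_cos_sq θ]
  rw [mem_sphere_zero_iff_norm]
  exact (sq_eq_sq₀ (norm_nonneg _) zero_le_one).mp (by rw [h1, one_pow])

/-- The point `(√(1-x²) cos θ, √(1-x²) sin θ, x)` of `S²` with height `x ∈ [-1,1]` and longitude `θ`
(a height outside `[-1,1]` is replaced by the nearest point of `[-1,1]`). -/
def cylinderPoint (x θ : ℝ) : S2 :=
  ⟨!₂[√(1 - (projIcc (-1 : ℝ) 1 (by norm_num) x : ℝ) ^ 2) * cos θ,
      √(1 - (projIcc (-1 : ℝ) 1 (by norm_num) x : ℝ) ^ 2) * sin θ,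
      (projIcc (-1 : ℝ) 1 (by norm_num) x : ℝ)],
    norm_cylinder_vec _ θ (projIcc (-1 : ℝ) 1 (by norm_num) x).2⟩

section

variable {M : Type*} [TopologicalSpace M] [ChartedSpace (EuclideanSpace ℝ (Fin 2)) M]

/-- The point of `M` with coordinates `(x, θ)`, where `M` is identified with `S²` by `Φ`.
For `x ∈ (-1,1)` these coordinates cover `M` minus the two poles; the poles are `x = ±1`. -/
def coordPoint (Φ : M ≃ₘ⟮𝓡 2, 𝓡 2⟯ S2) (x θ : ℝ) : M := Φ.symm (cylinderPoint x θ)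

/-- The coordinate vector `∂/∂x` at the point with coordinates `(x, θ)`. -/
def coordVecX (Ψ : ℝ → ℝ → M) (x θ : ℝ) : TangentSpace (𝓡 2) (Ψ x θ) :=
  mfderiv 𝓘(ℝ, ℝ) (𝓡 2) (fun s : ℝ => Ψ s θ) x (1 : ℝ)

/-- The coordinate vector `∂/∂θ` at the point with coordinates `(x, θ)`. -/
def coordVecTheta (Ψ : ℝ → ℝ → M) (x θ : ℝ) : TangentSpace (𝓡 2) (Ψ x θ) :=
  mfderiv 𝓘(ℝ, ℝ) (𝓡 2) (fun t : ℝ => Ψ x t) θ (1 : ℝ)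

variable [IsManifold (𝓡 2) ∞ M]

/-- `g_xx`. -/
def gramE (g : SurfaceMetric M) (Ψ : ℝ → ℝ → M) (x θ : ℝ) : ℝ :=
  g.inner (Ψ x θ) (coordVecX Ψ x θ) (coordVecX Ψ x θ)

/-- `g_xθ`. -/
def gramF (g : SurfaceMetric M) (Ψ : ℝ → ℝ → M) (x θ : ℝ) : ℝ :=
  g.inner (Ψ x θ) (coordVecX Ψ x θ) (coordVecTheta Ψ x θ)

/-- `g_θθ`. -/
def gramG (g : SurfaceMetric M) (Ψ : ℝ → ℝ → M) (x θ : ℝ) : ℝ :=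
  g.inner (Ψ x θ) (coordVecTheta Ψ x θ) (coordVecTheta Ψ x θ)

/-- The area density `√(det g)` in the coordinates `(x, θ)`. -/
def areaDensity (g : SurfaceMetric M) (Ψ : ℝ → ℝ → M) (x θ : ℝ) : ℝ :=
  √(gramE g Ψ x θ * gramG g Ψ x θ - gramF g Ψ x θ ^ 2)

/-- The Laplace–Beltrami operator `Δ u = (det g)^(-1/2) ∂_i ((det g)^(1/2) g^{ij} ∂_j u)` of the
metric `g`, at the point with coordinates `(x, θ)`. With `D = √(det g)` it reads
`D⁻¹ (∂_x ((g_θθ u_x - g_xθ u_θ) / D) + ∂_θ ((g_xx u_θ - g_xθ u_x) / D))`. -/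
def laplaceBeltrami (g : SurfaceMetric M) (Ψ : ℝ → ℝ → M) (u : M → ℝ) (x θ : ℝ) : ℝ :=
  (areaDensity g Ψ x θ)⁻¹ *
    (deriv (fun s : ℝ =>
        (gramG g Ψ s θ * deriv (fun r : ℝ => u (Ψ r θ)) s
          - gramF g Ψ s θ * deriv (fun r : ℝ => u (Ψ s r)) θ) / areaDensity g Ψ s θ) x
      + deriv (fun t : ℝ =>
        (gramE g Ψ x t * deriv (fun r : ℝ => u (Ψ x r)) t
          - gramF g Ψ x t * deriv (fun r : ℝ => u (Ψ r t)) x) / areaDensity g Ψ x t) θ)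

/-- `(M, g)` with a given action of the circle group is an `S¹`-invariant Riemannian manifold,
diffeomorphic to `S²` by `Φ`, whose metric in the coordinates `(x, θ)`, `-1 < x < 1`, is
`g = dx² / f(x) + f(x) dθ²`, the circle acting by translation of `θ`. The area is then `4π`, since
`det g = 1` and `(x, θ)` ranges over `(-1,1) × [0,2π)`. -/
structure IsMomentumForm [MulAction Circle M] (g : SurfaceMetric M) (f : ℝ → ℝ)
    (Φ : M ≃ₘ⟮𝓡 2, 𝓡 2⟯ S2) : Prop where
  smul_smooth : ∀ c : Circle, ContMDiff (𝓡 2) (𝓡 2) ∞ (fun p : M => c • p)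
  smul_isometry : ∀ (c : Circle) (p : M) (v w : TangentSpace (𝓡 2) p),
    g.inner (c • p) (mfderiv (𝓡 2) (𝓡 2) (fun q : M => c • q) p v)
      (mfderiv (𝓡 2) (𝓡 2) (fun q : M => c • q) p w) = g.inner p v w
  smul_coord : ∀ t x θ : ℝ, x ∈ Icc (-1 : ℝ) 1 →
    Circle.exp t • coordPoint Φ x θ = coordPoint Φ x (θ + t)
  f_smooth : ContDiffOn ℝ ∞ f (Icc (-1) 1)
  f_pos : ∀ x ∈ Ioo (-1 : ℝ) 1, 0 < f x
  f_left : f (-1) = 0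
  f_right : f 1 = 0
  f_deriv_left : HasDerivWithinAt f 2 (Icc (-1) 1) (-1)
  f_deriv_right : HasDerivWithinAt f (-2) (Icc (-1) 1) 1
  metric_xx : ∀ x ∈ Ioo (-1 : ℝ) 1, ∀ θ : ℝ, gramE g (coordPoint Φ) x θ = 1 / f x
  metric_xtheta : ∀ x ∈ Ioo (-1 : ℝ) 1, ∀ θ : ℝ, gramF g (coordPoint Φ) x θ = 0
  metric_thetatheta : ∀ x ∈ Ioo (-1 : ℝ) 1, ∀ θ : ℝ, gramG g (coordPoint Φ) x θ = f x

/-- `lam` is an `S¹`-invariant eigenvalue: `-Δ u = lam u` for some nonzero smooth `S¹`-invariant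
function `u` on `M`. The equation is written in the coordinates `(x, θ)`, that is, off the two
poles; as both sides are continuous on `M`, it then holds on all of `M`. -/
def IsInvariantEigenvalue [MulAction Circle M] (g : SurfaceMetric M)
    (Φ : M ≃ₘ⟮𝓡 2, 𝓡 2⟯ S2) (lam : ℝ) : Prop :=
  ∃ u : M → ℝ, ContMDiff (𝓡 2) 𝓘(ℝ, ℝ) ∞ u ∧ u ≠ 0 ∧
    (∀ (c : Circle) (p : M), u (c • p) = u p) ∧
    ∀ x ∈ Ioo (-1 : ℝ) 1, ∀ θ : ℝ,
      -laplaceBeltrami g (coordPoint Φ) u x θ = lam * u (coordPoint Φ x θ)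

/-- `lam` is the first (smallest) nonzero `S¹`-invariant eigenvalue; all eigenvalues of `-Δ` are
nonnegative, so nonzero means positive. -/
def IsFirstInvariantEigenvalue [MulAction Circle M] (g : SurfaceMetric M)
    (Φ : M ≃ₘ⟮𝓡 2, 𝓡 2⟯ S2) (lam : ℝ) : Prop :=
  IsLeast {μ : ℝ | μ ≠ 0 ∧ IsInvariantEigenvalue g Φ μ} lam

/-- `(M, g)` is isometric to the sphere with its canonical metric. -/
def IsIsometricToRoundSphere (g : SurfaceMetric M) : Prop :=
  ∃ F : M ≃ₘ⟮𝓡 2, 𝓡 2⟯ S2, ∀ (p : M) (v w : TangentSpace (𝓡 2) p),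
    roundInner (F p) (mfderiv (𝓡 2) (𝓡 2) F p v) (mfderiv (𝓡 2) (𝓡 2) F p w) = g.inner p v w

end

end

open MeasureTheory Filter Topology BoundedContinuousFunction

/-! The area density in the coordinates `(x, θ)` is one, so an invariant function `U(x)` is an
eigenfunction when `(f U')' = -λ U`. Put `w = f U'`. Then `w' = -λ U` and `w'' = -λ w / f`, with `w
= 0` at both ends: the nonzero invariant spectrum is the Dirichlet spectrum of this equation, and
the constants have disappeared. The boundary conditions on `f` give `f = (1 - x²) p` with `p`
positive, smooth on `[-1, 1]` and equal to one at `±1` (`exists_profile_factor`).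

The inequality is the Rayleigh quotient of the test function `φ = 1 - x²`, in the form of Picone's
identity (`hasDerivAt_picone`) for a positive solution `w`. The boundary terms vanish, which leaves
`l ∫ (1 - x²)/p ≤ 8/3`. Cauchy–Schwarz, `∫ (1 - x²)/p · ∫ (1 - x²) p ≥ (4/3)²`, then gives `l ≤
(3/2) ∫ f`, and equality forces `p` to be constant, hence one (`IsPositiveSolution.le_integral`).
Picone's identity also yields Sturm comparison (`eq_zero_of_lt`): an eigenvalue with a positive
eigenfunction is the smallest one.

A positive eigenfunction is found by shooting from `-1` (`exists_shooting`,
`exists_positive_eigenfunction`): take the largest parameter for which the solution stays positive.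
A bootstrap makes it smooth up to the end points (`IsSturmLiouvilleSolution.contDiffOn`), so it
lifts to a smooth function on `M`.

For the rigidity statement, an isometry with the round sphere gives curvature one, that is `f'' =
-2` (`deriv_deriv_eq_of_isometric`), and `f(±1) = 0` then gives `f = 1 - x²`. Conversely, for this
profile `Φ` is an isometry off the poles by computation in coordinates, and at the poles by
continuity (`inner_ambientDeriv_of_pole`). -/

/-- The point of `[-1, 1]` nearest to `x`. -/
noncomputable def clamp (x : ℝ) : ℝ := max (-1) (min x 1)

lemma clamp_mem (x : ℝ) : clamp x ∈ Icc (-1 : ℝ) 1 :=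
  ⟨le_max_left _ _, max_le (by norm_num) (min_le_right _ _)⟩

lemma clamp_of_mem {x : ℝ} (hx : x ∈ Icc (-1 : ℝ) 1) : clamp x = x := by
  rw [clamp, min_eq_left hx.2, max_eq_right hx.1]

lemma continuous_clamp : Continuous clamp := by unfold clamp; fun_prop

/-! ### Volterra integral equations on `[-1, 1]` -/

/-- Factorial decay makes some power of `-l a` have norm below one, whatever the size of `l`. So `1
- (-l a)ⁿ` is invertible, and its factor `1 + l a` in the geometric sum commutes with the cofactor.
-/
lemma isUnit_one_add_smul {A : Type*} [NormedRing A] [NormedAlgebra ℝ A] [CompleteSpace A] {a : A}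
    {B : ℝ} (ha : ∀ n : ℕ, ‖a ^ n‖ ≤ B ^ n / n.factorial) (l : ℝ) : IsUnit (1 + l • a) := by
  obtain ⟨n, hn⟩ : ∃ n : ℕ, (|l| * B) ^ n / n.factorial < 1 :=
    ((FloorSemiring.tendsto_pow_div_factorial_atTop (|l| * B)).eventually
      (gt_mem_nhds one_pos)).exists
  have h1 : ‖(-(l • a)) ^ n‖ < 1 := by
    refine lt_of_le_of_lt ?_ hn
    rw [← neg_smul, smul_pow, norm_smul, norm_pow, norm_neg, mul_pow, mul_div_assoc]
    exact mul_le_mul_of_nonneg_left (ha n) (by positivity)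
  have h2 : IsUnit (1 - (-(l • a)) ^ n) := (Units.oneSub _ h1).isUnit
  rw [← mul_neg_geom_sum] at h2
  have hc : Commute (1 - -(l • a)) (∑ i ∈ Finset.range n, (-(l • a)) ^ i) := by
    refine Commute.sum_right _ _ _ fun i _ => ?_
    exact ((Commute.one_left _).sub_left (Commute.refl _)).pow_right i
  simpa using (hc.isUnit_mul_iff.1 h2).1

lemma continuous_inverse_one_add_smul {A : Type*} [NormedRing A] [NormedAlgebra ℝ A]
    [CompleteSpace A] {a : A} {B : ℝ} (ha : ∀ n : ℕ, ‖a ^ n‖ ≤ B ^ n / n.factorial) :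
    Continuous fun l : ℝ => Ring.inverse (1 + l • a) := by
  refine continuous_iff_continuousAt.2 fun l => ?_
  obtain ⟨u, hu⟩ := isUnit_one_add_smul ha l
  have h1 := NormedRing.inverse_continuousAt u
  rw [hu] at h1
  exact h1.comp (f := fun l : ℝ => 1 + l • a) (by fun_prop)

/-- A bounded kernel on `[-1, 1]` vanishing above the diagonal. -/
structure IsVolterraKernel (K : ℝ → ℝ → ℝ) (C : ℝ) : Prop where
  measurable : ∀ x, Measurable (K x)
  continuous : ∀ t ∈ Ioo (-1 : ℝ) 1, Continuous fun x => K x t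
  bound : ∀ x ∈ Icc (-1 : ℝ) 1, ∀ t ∈ Ioo (-1 : ℝ) 1, |K x t| ≤ C
  eq_zero : ∀ x t, x ≤ t → K x t = 0

namespace IsVolterraKernel

variable {K : ℝ → ℝ → ℝ} {C : ℝ} (hK : IsVolterraKernel K C)

include hK

lemma nonneg : 0 ≤ C :=
  (abs_nonneg _).trans (hK.bound 0 (by norm_num) 0 (by norm_num))

lemma norm_mul_le (v : ℝ →ᵇ ℝ) (x : ℝ) {t : ℝ} (ht : t ∈ Ioo (-1 : ℝ) 1) :
    ‖K (clamp x) t * v t‖ ≤ C * ‖v‖ := by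
  rw [norm_mul]
  exact mul_le_mul (hK.bound _ (clamp_mem x) t ht) (v.norm_coe_le_norm t) (norm_nonneg _) hK.nonneg

lemma aestronglyMeasurable (v : ℝ →ᵇ ℝ) (x : ℝ) :
    AEStronglyMeasurable (fun t => K (clamp x) t * v t) (volume.restrict (Ioo (-1 : ℝ) 1)) :=
  ((hK.measurable _).mul v.continuous.measurable).aestronglyMeasurable

lemma integrableOn (v : ℝ →ᵇ ℝ) (x : ℝ) :
    IntegrableOn (fun t => K (clamp x) t * v t) (Ioo (-1 : ℝ) 1) :=
  Measure.integrableOn_of_bounded (by simp)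
    ((hK.measurable _).mul v.continuous.measurable).aestronglyMeasurable
    (ae_restrict_of_forall_mem measurableSet_Ioo fun _ ht => hK.norm_mul_le v x ht)

lemma continuous_integral (v : ℝ →ᵇ ℝ) :
    Continuous fun x => ∫ t in Ioo (-1 : ℝ) 1, K (clamp x) t * v t := by
  refine continuous_of_dominated (bound := fun _ => C * ‖v‖) (hK.aestronglyMeasurable v) (fun x => ?_)
    (integrable_const _) ?_
  · exact ae_restrict_of_forall_mem measurableSet_Ioo fun _ ht => hK.norm_mul_le v x ht
  · refine ae_restrict_of_forall_mem measurableSet_Ioo fun t ht => ?_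
    exact ((hK.continuous t ht).comp continuous_clamp).mul continuous_const

lemma norm_integral_le (v : ℝ →ᵇ ℝ) (x : ℝ) :
    ‖∫ t in Ioo (-1 : ℝ) 1, K (clamp x) t * v t‖ ≤ C * ‖v‖ * 2 := by
  refine (norm_setIntegral_le_of_norm_le_const (by simp) fun t ht => hK.norm_mul_le v x ht).trans ?_
  norm_num [measureReal_def]

/-- The integral operator of a Volterra kernel. -/
noncomputable def op : (ℝ →ᵇ ℝ) →L[ℝ] (ℝ →ᵇ ℝ) :=
  LinearMap.mkContinuous
    { toFun := fun v => ofNormedAddCommGroup _ (hK.continuous_integral v) _ (hK.norm_integral_le v)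
      map_add' := fun v w => by
        ext x
        simp only [coe_ofNormedAddCommGroup, coe_add, Pi.add_apply, mul_add]
        exact integral_add (hK.integrableOn v x) (hK.integrableOn w x)
      map_smul' := fun c v => by
        ext x
        simp only [coe_ofNormedAddCommGroup, coe_smul, smul_eq_mul, RingHom.id_apply,
          mul_left_comm _ c]
        exact integral_const_mul _ _ }
    (2 * C) fun v => by
      refine (norm_le (by have := hK.nonneg; positivity)).2 fun x => ?_
      exact (hK.norm_integral_le v x).trans (by linarith)

lemma op_apply (v : ℝ →ᵇ ℝ) (x : ℝ) :
    hK.op v x = ∫ t in Ioo (-1 : ℝ) 1, K (clamp x) t * v t := rfl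

/-- The kernel vanishes for `t ≥ x`, so each application integrates the previous bound over `(-1,
x)` only; integrating `(1 + t)ⁿ` produces the factor `1 / (n + 1)` that builds the factorial. -/
lemma abs_op_pow_le (v : ℝ →ᵇ ℝ) (n : ℕ) (x : ℝ) :
    |(hK.op ^ n) v x| ≤ ‖v‖ * C ^ n / n.factorial * (1 + clamp x) ^ n := by
  induction n generalizing x with
  | zero => simpa using v.norm_coe_le_norm x
  | succ n ih =>
    have hC := hK.nonneg
    have h1 : (hK.op ^ (n + 1)) v x = ∫ t in Ioo (-1 : ℝ) 1, K (clamp x) t * (hK.op ^ n) v t := by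
      rw [pow_succ']; exact hK.op_apply _ x
    have hX := clamp_mem x
    set X := clamp x
    set A := ‖v‖ * C ^ n / n.factorial with hA
    have hA0 : 0 ≤ A := by positivity
    have hgc : Continuous fun t : ℝ => C * (A * (1 + t) ^ n) := by fun_prop
    have h2 : ∀ t ∈ Ioo (-1 : ℝ) 1, ‖K X t * (hK.op ^ n) v t‖ ≤
        (Ioo (-1) X).indicator (fun t => C * (A * (1 + t) ^ n)) t := by
      intro t ht
      by_cases htX : t < X
      · rw [indicator_of_mem (show t ∈ Ioo (-1) X from ⟨ht.1, htX⟩), norm_mul]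
        have h3 := ih t
        rw [clamp_of_mem ⟨ht.1.le, ht.2.le⟩] at h3
        exact mul_le_mul (hK.bound X hX t ht) h3 (norm_nonneg _) hC
      · rw [hK.eq_zero X t (not_lt.1 htX), indicator_of_notMem (fun h => htX h.2)]
        simp
    have h4 : |(hK.op ^ (n + 1)) v x| ≤ ∫ t in Ioo (-1 : ℝ) 1,
        (Ioo (-1) X).indicator (fun t => C * (A * (1 + t) ^ n)) t := by
      rw [h1]
      refine norm_integral_le_of_norm_le ?_ (ae_restrict_of_forall_mem measurableSet_Ioo h2)
      refine Integrable.indicator ?_ measurableSet_Ioo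
      exact (hgc.integrableOn_Icc (a := -1) (b := 1)).mono_set Ioo_subset_Icc_self
    refine h4.trans (le_of_eq ?_)
    rw [setIntegral_indicator measurableSet_Ioo,
      inter_eq_right.2 (Ioo_subset_Ioo_right hX.2), ← integral_Ioc_eq_integral_Ioo,
      ← intervalIntegral.integral_of_le hX.1,
      intervalIntegral.integral_eq_sub_of_hasDerivAt
        (f := fun t => C * A / (n + 1) * (1 + t) ^ (n + 1)) (fun t _ => ?_)
        (hgc.intervalIntegrable _ _), hA, Nat.factorial_succ]
    · push_cast
      field_simp
      simp
      ring
    · have h5 := (((hasDerivAt_id t).const_add 1).pow (n + 1)).const_mul (C * A / (n + 1))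
      refine h5.congr_deriv ?_
      simp
      field_simp

lemma norm_op_pow_le (n : ℕ) : ‖hK.op ^ n‖ ≤ (2 * C) ^ n / n.factorial := by
  have hC := hK.nonneg
  refine ContinuousLinearMap.opNorm_le_bound _ (by positivity) fun v => ?_
  refine (norm_le (by positivity)).2 fun x => (hK.abs_op_pow_le v n x).trans ?_
  have hX := clamp_mem x
  have h : (1 + clamp x) ^ n ≤ 2 ^ n :=
    pow_le_pow_left₀ (by linarith [hX.1]) (by linarith [hX.2]) n
  calc _ ≤ ‖v‖ * C ^ n / n.factorial * 2 ^ n := mul_le_mul_of_nonneg_left h (by positivity)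
    _ = _ := by rw [mul_pow]; ring

/-- The solutions of `v = 1 - l K v` depend continuously on `l`. -/
theorem exists_solution : ∃ V : ℝ → (ℝ →ᵇ ℝ), Continuous V ∧ ∀ l, ∀ x ∈ Icc (-1 : ℝ) 1,
    V l x = 1 - l * ∫ t in Ioo (-1 : ℝ) 1, K x t * V l t := by
  -- The solution is `(1 + l K)⁻¹ 1`; inversion is continuous at units, so the dependence on `l` is
  -- continuous in the sup norm.
  refine ⟨fun l => Ring.inverse (1 + l • hK.op) 1, ?_, fun l x hx => ?_⟩
  · exact (continuous_inverse_one_add_smul (A := (ℝ →ᵇ ℝ) →L[ℝ] (ℝ →ᵇ ℝ)) hK.norm_op_pow_le).clm_apply continuous_const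
  · have h := congrArg (fun A : (ℝ →ᵇ ℝ) →L[ℝ] (ℝ →ᵇ ℝ) => A 1 x)
      (Ring.mul_inverse_cancel _ (isUnit_one_add_smul (A := (ℝ →ᵇ ℝ) →L[ℝ] (ℝ →ᵇ ℝ)) hK.norm_op_pow_le l))
    simp only [mul_apply_eq_comp, _root_.add_apply,
      one_apply_eq_self, _root_.smul_apply, coe_add, Pi.add_apply,
      coe_smul, coe_one, Pi.one_apply, smul_eq_mul] at h
    rw [hK.op_apply, clamp_of_mem hx] at h
    linarith

end IsVolterraKernel

/-! ### The singular initial value problem at `-1` -/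

/-- `w'' = -l w / ((1 - x²) p)` on `(-1, 1)`, with `dw = w'`. -/
def IsSturmLiouvilleSolution (p : ℝ → ℝ) (l : ℝ) (w dw : ℝ → ℝ) : Prop :=
  ∀ x ∈ Ioo (-1 : ℝ) 1,
    HasDerivAt w (dw x) x ∧ HasDerivAt dw (-(l * w x / ((1 - x ^ 2) * p x))) x

/-- The kernel of the Volterra equation for `w / (1 + x)`. -/
noncomputable def shootingKernel (p : ℝ → ℝ) (x t : ℝ) : ℝ :=
  max 0 (x - t) / (max (1 + x) (1 + t) * (1 - t) * p t)

/-- Integrating the equation twice and dividing by `1 + x` leaves the kernel `(x - t) / ((1 + x)(1 -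
t) p t)` on `t < x`. It is bounded despite the singular ends because `(1 + x)(1 - t) - (x - t) = 1 -
x t ≥ 0`. The two `max` cut it off above the diagonal and keep the denominator positive at `x = -1`.
-/
lemma isVolterraKernel_shootingKernel {p : ℝ → ℝ} (hp : Continuous p) (hpos : ∀ x, 0 < p x) :
    ∃ C, IsVolterraKernel (shootingKernel p) C := by
  obtain ⟨t₀, -, ht₀⟩ := (isCompact_Icc (a := (-1 : ℝ)) (b := 1)).exists_isMinOn
    (nonempty_Icc.2 (by norm_num)) hp.continuousOn
  refine ⟨1 / p t₀, fun x => ?_, fun t ht => ?_, fun x hx t ht => ?_, fun x t hxt => ?_⟩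
  · unfold shootingKernel
    have := hp.measurable
    fun_prop
  · unfold shootingKernel
    refine Continuous.div (by fun_prop) (by fun_prop) fun x => ?_
    have h1 : 0 < max (1 + x) (1 + t) := lt_max_of_lt_right (by linarith [ht.1])
    have h2 : 0 < 1 - t := by linarith [ht.2]
    have := hpos t
    positivity
  · have h1 : 0 < max (1 + x) (1 + t) := lt_max_of_lt_right (by linarith [ht.1])
    have h2 : 0 < 1 - t := by linarith [ht.2]
    have h3 := hpos t
    have h4 : 0 ≤ max 0 (x - t) := le_max_left _ _
    have h5 : p t₀ ≤ p t := ht₀ ⟨ht.1.le, ht.2.le⟩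
    have h6 : max 0 (x - t) ≤ max (1 + x) (1 + t) * (1 - t) := by
      have h7 : 1 + x ≤ max (1 + x) (1 + t) := le_max_left _ _
      refine max_le (by positivity) (le_trans ?_ (mul_le_mul_of_nonneg_right h7 h2.le))
      nlinarith [hx.1, hx.2, ht.1, ht.2]
    unfold shootingKernel
    rw [abs_of_nonneg (by positivity), ← div_div]
    exact div_le_div₀ zero_le_one ((div_le_one (by positivity)).2 h6) (hpos _) h5
  · simp [shootingKernel, hxt]

lemma hasDerivAt_integral_of_continuousOn_Iio {r : ℝ → ℝ} (hr : ContinuousOn r (Iio 1)) {x : ℝ}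
    (hx : x < 1) : HasDerivAt (fun x => ∫ t in (-1 : ℝ)..x, r t) (r x) x := by
  refine intervalIntegral.integral_hasDerivAt_right ?_ ?_ (hr.continuousAt (Iio_mem_nhds hx))
  · refine (hr.mono fun t ht => ?_).intervalIntegrable
    exact lt_of_le_of_lt ht.2 (max_lt (by norm_num) hx)
  · exact hr.stronglyMeasurableAtFilter isOpen_Iio x hx

/-- The solutions of the singular initial value problem `w(-1) = 0`, `w'(-1) = 1`, in the form
`w = (1 + x) V`. -/
theorem exists_shooting {p : ℝ → ℝ} (hp : Continuous p) (hpos : ∀ x, 0 < p x) :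
    ∃ (V : ℝ → (ℝ →ᵇ ℝ)) (D : ℝ → ℝ → ℝ), Continuous V ∧ (∀ x ∈ Icc (-1 : ℝ) 1, V 0 x = 1) ∧
      ∀ l, V l (-1) = 1 ∧ ContinuousOn (D l) (Iio 1) ∧
        IsSturmLiouvilleSolution p l (fun x => (1 + x) * V l x) (D l) := by
  obtain ⟨C, hK⟩ := isVolterraKernel_shootingKernel hp hpos
  obtain ⟨V, hV, hVeq⟩ := hK.exists_solution
  have hr : ∀ l, ContinuousOn (fun t => V l t / ((1 - t) * p t)) (Iio 1) := fun l =>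
    (V l).continuous.continuousOn.div (by fun_prop) fun t ht =>
      mul_ne_zero (sub_ne_zero.2 (ne_of_gt ht)) (hpos t).ne'
  have hD : ∀ l, ∀ x < 1, HasDerivAt (fun x => 1 - l * ∫ t in (-1 : ℝ)..x, V l t / ((1 - t) * p t))
      (-(l * (V l x / ((1 - x) * p x)))) x := fun l x hx =>
    ((hasDerivAt_integral_of_continuousOn_Iio (hr l) hx).const_mul l).const_sub 1
  refine ⟨V, fun l x => 1 - l * ∫ t in (-1 : ℝ)..x, V l t / ((1 - t) * p t), hV,
    fun x hx => by rw [hVeq 0 x hx]; simp, fun l => ⟨?_, ?_, fun x hx => ⟨?_, ?_⟩⟩⟩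
  · rw [hVeq l _ (by simp), setIntegral_congr_fun (g := fun _ => (0 : ℝ)) measurableSet_Ioo]
    · simp
    · intro t ht
      simp [hK.eq_zero (-1) t ht.1.le]
  · exact fun x hx => (hD l x hx).continuousAt.continuousWithinAt
  · have hr' : ContinuousOn (fun t => t * (V l t / ((1 - t) * p t))) (Iio 1) :=
      continuousOn_id.mul (hr l)
    -- Splitting the factor `y - t` moves `y` out of the integral, so that the fundamental theorem
    -- of calculus applies to each term. On differentiation the two boundary contributions cancel.
    have h1 : ∀ y ∈ Ioo (-1 : ℝ) 1, (1 + y) * V l y = (1 + y) - l *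
        (y * (∫ t in (-1 : ℝ)..y, V l t / ((1 - t) * p t)) -
          ∫ t in (-1 : ℝ)..y, t * (V l t / ((1 - t) * p t))) := by
      intro y hy
      have hi : ∀ {r : ℝ → ℝ}, ContinuousOn r (Iio 1) → IntervalIntegrable r volume (-1) y :=
        fun h => (h.mono fun t ht => lt_of_le_of_lt ht.2 (max_lt (by norm_num) hy.2)).intervalIntegrable
      rw [← intervalIntegral.integral_const_mul, ← intervalIntegral.integral_sub
        ((hi (hr l)).const_mul _) (hi hr'), hVeq l y ⟨hy.1.le, hy.2.le⟩, mul_sub, mul_one,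
        mul_left_comm, ← integral_const_mul, intervalIntegral.integral_of_le hy.1.le,
        integral_Ioc_eq_integral_Ioo]
      congr 2
      have h2 : Ioo (-1 : ℝ) 1 ∩ Ioo (-1) y = Ioo (-1) y :=
        inter_eq_right.2 (Ioo_subset_Ioo_right hy.2.le)
      rw [← h2, ← setIntegral_indicator measurableSet_Ioo]
      refine setIntegral_congr_fun measurableSet_Ioo fun t ht => ?_
      by_cases hty : t < y
      · have h3 : 0 < 1 + y := by linarith [hy.1]
        have h4 : 0 < 1 - t := by linarith [ht.2]
        have h5 := hpos t
        rw [indicator_of_mem (show t ∈ Ioo (-1) y from ⟨ht.1, hty⟩)]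
        simp only [shootingKernel]
        rw [max_eq_right (by linarith), max_eq_left (by linarith)]
        field_simp
      · rw [hK.eq_zero y t (not_lt.1 hty), indicator_of_notMem fun h => hty h.2]
        simp
    have h2 := ((hasDerivAt_id x).const_add 1).sub
      ((((hasDerivAt_id x).mul (hasDerivAt_integral_of_continuousOn_Iio (hr l) hx.2)).sub
        (hasDerivAt_integral_of_continuousOn_Iio hr' hx.2)).const_mul l)
    refine (h2.congr_of_eventuallyEq ?_).congr_deriv ?_
    · filter_upwards [Ioo_mem_nhds hx.1 hx.2] with y hy
      simpa using h1 y hy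
    · simp
  · refine (hD l x hx.2).congr_deriv ?_
    have h3 : 1 + x ≠ 0 := by linarith [hx.1]
    have h4 : 1 - x ≠ 0 := by linarith [hx.2]
    have h5 := (hpos x).ne'
    rw [show 1 - x ^ 2 = (1 + x) * (1 - x) by ring]
    field_simp

/-! ### Picone's identity, Sturm comparison and the Rayleigh bound -/

/-- Replaces integration over the open interval: monotonicity compares the two boundary limits with
no integrability assumption on `h'`, and equal limits force `h` to be constant. -/
lemma le_and_deriv_eq_zero_of_tendsto {h h' : ℝ → ℝ} {a b : ℝ}
    (hd : ∀ x ∈ Ioo (-1 : ℝ) 1, HasDerivAt h (h' x) x) (h0 : ∀ x ∈ Ioo (-1 : ℝ) 1, 0 ≤ h' x)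
    (ha : Tendsto h (𝓝[>] (-1)) (𝓝 a)) (hb : Tendsto h (𝓝[<] 1) (𝓝 b)) :
    a ≤ b ∧ (a = b → ∀ x ∈ Ioo (-1 : ℝ) 1, h' x = 0) := by
  have hmono : MonotoneOn h (Ioo (-1) 1) := by
    refine monotoneOn_of_deriv_nonneg (convex_Ioo _ _)
      (fun x hx => (hd x hx).continuousAt.continuousWithinAt) ?_ ?_ <;> rw [interior_Ioo]
    · exact fun x hx => (hd x hx).differentiableAt.differentiableWithinAt
    · exact fun x hx => by rw [(hd x hx).deriv]; exact h0 x hx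
  have hle : ∀ x ∈ Ioo (-1 : ℝ) 1, a ≤ h x := fun x hx => by
    refine le_of_tendsto ha ?_
    filter_upwards [Ioo_mem_nhdsGT hx.1] with y hy
    exact hmono ⟨hy.1, hy.2.trans hx.2⟩ hx hy.2.le
  have hge : ∀ x ∈ Ioo (-1 : ℝ) 1, h x ≤ b := fun x hx => by
    refine ge_of_tendsto hb ?_
    filter_upwards [Ioo_mem_nhdsLT hx.2] with y hy
    exact hmono hx ⟨hx.1.trans hy.1, hy.2⟩ hy.1.le
  refine ⟨(hle 0 (by norm_num)).trans (hge 0 (by norm_num)), fun hab x hx => ?_⟩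
  have h1 : h =ᶠ[𝓝 x] fun _ => a := by
    filter_upwards [Ioo_mem_nhds hx.1 hx.2] with y hy
    exact le_antisymm ((hge y hy).trans hab.ge) (hle y hy)
  exact (hd x hx).unique ((hasDerivAt_const x a).congr_of_eventuallyEq h1)

lemma tendsto_zero_of_abs_le {h : ℝ → ℝ} {M : ℝ}
    (hM : ∀ x ∈ Ioo (-1 : ℝ) 1, |h x| ≤ M * (1 - x ^ 2)) :
    Tendsto h (𝓝[>] (-1)) (𝓝 0) ∧ Tendsto h (𝓝[<] 1) (𝓝 0) := by
  have hc : Continuous fun x : ℝ => M * (1 - x ^ 2) := by fun_prop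
  constructor
  · have h1 : Tendsto (fun x : ℝ => M * (1 - x ^ 2)) (𝓝[>] (-1)) (𝓝 0) := by
      simpa using (hc.tendsto (-1)).mono_left nhdsWithin_le_nhds
    refine squeeze_zero_norm' ?_ h1
    filter_upwards [Ioo_mem_nhdsGT (show (-1 : ℝ) < 1 by norm_num)] with x hx using hM x hx
  · have h1 : Tendsto (fun x : ℝ => M * (1 - x ^ 2)) (𝓝[<] 1) (𝓝 0) := by
      simpa using (hc.tendsto 1).mono_left nhdsWithin_le_nhds
    refine squeeze_zero_norm' ?_ h1
    filter_upwards [Ioo_mem_nhdsLT (show (-1 : ℝ) < 1 by norm_num)] with x hx using hM x hx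

lemma one_sub_sq_pos {x : ℝ} (hx : x ∈ Ioo (-1 : ℝ) 1) : 0 < 1 - x ^ 2 := by
  nlinarith [hx.1, hx.2]

/-- A solution which is positive on `(-1, 1)` and vanishes at `-1`. -/
structure IsPositiveSolution (p : ℝ → ℝ) (l : ℝ) (w dw : ℝ → ℝ) : Prop where
  sol : IsSturmLiouvilleSolution p l w dw
  continuousOn : ContinuousOn w (Icc (-1) 1)
  pos : ∀ x ∈ Ioo (-1 : ℝ) 1, 0 < w x
  left : w (-1) = 0
  right : 0 ≤ w 1

namespace IsPositiveSolution

variable {p : ℝ → ℝ} {l : ℝ} {w dw : ℝ → ℝ}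

lemma antitoneOn (hpos : ∀ x, 0 < p x) (hl : 0 ≤ l) (hs : IsSturmLiouvilleSolution p l w dw)
    (hw : ∀ x ∈ Ioo (-1 : ℝ) 1, 0 ≤ w x) : AntitoneOn dw (Ioo (-1) 1) := by
  refine antitoneOn_of_deriv_nonpos (convex_Ioo _ _)
    (fun x hx => (hs x hx).2.continuousAt.continuousWithinAt) ?_ ?_ <;> rw [interior_Ioo]
  · exact fun x hx => (hs x hx).2.differentiableAt.differentiableWithinAt
  · intro x hx
    rw [(hs x hx).2.deriv, neg_nonpos]
    have := one_sub_sq_pos hx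
    have := hpos x
    have := hw x hx
    positivity

/-- A positive solution is concave, so its slope at `x` lies between the slopes of the chords to the
two end points. As `w(-1) = 0` and `w(1) ≥ 0`, this gives `-w ≤ (1 - x) w'` and `(1 + x) w' ≤ w`. -/
lemma abs_logDeriv_le (hpos : ∀ x, 0 < p x) (hl : 0 ≤ l) (hw : IsPositiveSolution p l w dw)
    {x : ℝ} (hx : x ∈ Ioo (-1 : ℝ) 1) : |(1 - x ^ 2) * (dw x / w x)| ≤ 2 := by
  have hanti := antitoneOn hpos hl hw.sol fun x hx => (hw.pos x hx).le
  have hwx := hw.pos x hx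
  have h1 : dw x * (1 + x) ≤ w x := by
    obtain ⟨c, hc, hc'⟩ := exists_hasDerivAt_eq_slope w dw hx.1
      (hw.continuousOn.mono (Icc_subset_Icc_right hx.2.le))
      fun y hy => (hw.sol y ⟨hy.1, hy.2.trans hx.2⟩).1
    have h2 := hanti ⟨hc.1, hc.2.trans hx.2⟩ hx hc.2.le
    rw [hc', hw.left, le_div_iff₀ (by linarith [hx.1])] at h2
    linarith
  have h2 : -w x ≤ dw x * (1 - x) := by
    obtain ⟨c, hc, hc'⟩ := exists_hasDerivAt_eq_slope w dw hx.2
      (hw.continuousOn.mono (Icc_subset_Icc_left hx.1.le))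
      fun y hy => (hw.sol y ⟨hx.1.trans hy.1, hy.2⟩).1
    have h2 := hanti hx ⟨hx.1.trans hc.1, hc.2⟩ hc.1.le
    rw [hc', div_le_iff₀ (by linarith [hx.2])] at h2
    linarith [hw.right]
  rw [← mul_div_assoc, abs_le, le_div_iff₀ hwx, div_le_iff₀ hwx]
  have h3 : 0 < 1 + x := by linarith [hx.1]
  have h4 : 0 < 1 - x := by linarith [hx.2]
  constructor
  · nlinarith [mul_le_mul_of_nonneg_right h2 h3.le]
  · nlinarith [mul_le_mul_of_nonneg_right h1 h4.le]

/-- With `q = w'/w`, the equation becomes the Riccati equation `q' = -l / ((1 - x²) p) - q²`, and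
the terms in `φ'`, `φ q` complete a square. -/
lemma hasDerivAt_picone (hw : IsPositiveSolution p l w dw) {φ dφ ddφ : ℝ → ℝ} {x : ℝ}
    (hx : x ∈ Ioo (-1 : ℝ) 1) (h1 : HasDerivAt φ (dφ x) x) (h2 : HasDerivAt dφ (ddφ x) x) :
    HasDerivAt (fun x => φ x * dφ x - φ x ^ 2 * (dw x / w x))
      ((dφ x - φ x * (dw x / w x)) ^ 2 + φ x * ddφ x + l * φ x ^ 2 / ((1 - x ^ 2) * p x)) x := by
  have hwx := (hw.pos x hx).ne'
  refine ((h1.mul h2).sub ((h1.pow 2).mul ((hw.sol x hx).2.div (hw.sol x hx).1 hwx))).congr_deriv ?_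
  simp only [div_eq_mul_inv, mul_inv, Pi.pow_apply, Pi.mul_apply, Pi.inv_apply]
  field_simp
  ring

/-- This kills the boundary terms: `w'/w` is at most of order `1 / (1 - x²)`, while `φ²` is of order
`(1 - x²)²`. -/
lemma abs_picone_le (hpos : ∀ x, 0 < p x) (hl : 0 ≤ l) (hw : IsPositiveSolution p l w dw)
    {φ dφ : ℝ → ℝ} {C C' : ℝ} (hφ : ∀ x ∈ Ioo (-1 : ℝ) 1, |φ x| ≤ C * (1 - x ^ 2))
    (hdφ : ∀ x ∈ Ioo (-1 : ℝ) 1, |dφ x| ≤ C') {x : ℝ} (hx : x ∈ Ioo (-1 : ℝ) 1) :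
    |φ x * dφ x - φ x ^ 2 * (dw x / w x)| ≤ (C * C' + C ^ 2 * 2) * (1 - x ^ 2) := by
  have hd := one_sub_sq_pos hx
  have h1 := hw.abs_logDeriv_le hpos hl hx
  have h2 := hφ x hx
  have h3 := hdφ x hx
  rw [abs_mul, abs_of_pos hd] at h1
  have h4 : |φ x * dφ x| ≤ C * (1 - x ^ 2) * C' := by
    rw [abs_mul]
    exact mul_le_mul h2 h3 (abs_nonneg _) ((abs_nonneg _).trans h2)
  have h5 : |φ x ^ 2 * (dw x / w x)| ≤ (C * (1 - x ^ 2)) ^ 2 * |dw x / w x| := by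
    rw [abs_mul, abs_pow]
    gcongr
  calc _ ≤ _ := abs_sub _ _
    _ ≤ C * (1 - x ^ 2) * C' + C ^ 2 * (1 - x ^ 2) * ((1 - x ^ 2) * |dw x / w x|) := by
      linarith
    _ ≤ C * (1 - x ^ 2) * C' + C ^ 2 * (1 - x ^ 2) * 2 := by gcongr
    _ = _ := by ring

/-- Sturm comparison: there is no nontrivial Dirichlet solution below a positive solution. -/
theorem eq_zero_of_lt (hpos : ∀ x, 0 < p x) (hl : 0 ≤ l) (hw : IsPositiveSolution p l w dw)
    {m : ℝ} (hm : m < l) {φ dφ : ℝ → ℝ} (hs : IsSturmLiouvilleSolution p m φ dφ) {C C' : ℝ}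
    (hφ : ∀ x ∈ Ioo (-1 : ℝ) 1, |φ x| ≤ C * (1 - x ^ 2))
    (hdφ : ∀ x ∈ Ioo (-1 : ℝ) 1, |dφ x| ≤ C') {x : ℝ} (hx : x ∈ Ioo (-1 : ℝ) 1) : φ x = 0 := by
  obtain ⟨h1, h2⟩ := tendsto_zero_of_abs_le fun x hx => hw.abs_picone_le hpos hl hφ hdφ hx
  -- The equation for `φ` cancels all but the surplus `(l - m) φ² / ((1 - x²) p)`, so Picone's
  -- derivative is a sum of two nonnegative terms. Both boundary limits are zero, hence both terms
  -- vanish.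
  have h3 : ∀ x ∈ Ioo (-1 : ℝ) 1, (dφ x - φ x * (dw x / w x)) ^ 2 +
      φ x * (-(m * φ x / ((1 - x ^ 2) * p x))) + l * φ x ^ 2 / ((1 - x ^ 2) * p x) =
      (dφ x - φ x * (dw x / w x)) ^ 2 + (l - m) * (φ x ^ 2 / ((1 - x ^ 2) * p x)) :=
    fun x _ => by ring
  have h4 : ∀ x ∈ Ioo (-1 : ℝ) 1, 0 ≤ (l - m) * (φ x ^ 2 / ((1 - x ^ 2) * p x)) := fun x hx => by
    have := one_sub_sq_pos hx
    have := hpos x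
    have : 0 < l - m := sub_pos.2 hm
    positivity
  have h5 := (le_and_deriv_eq_zero_of_tendsto
    (fun x hx => hw.hasDerivAt_picone (ddφ := fun x => -(m * φ x / ((1 - x ^ 2) * p x))) hx
      (hs x hx).1 (hs x hx).2)
    (fun x hx => by rw [h3 x hx]; exact add_nonneg (sq_nonneg _) (h4 x hx)) h1 h2).2 rfl x hx
  rw [h3 x hx] at h5
  have h6 := h4 x hx
  have h7 : (l - m) * (φ x ^ 2 / ((1 - x ^ 2) * p x)) = 0 := by
    nlinarith [sq_nonneg (dφ x - φ x * (dw x / w x))]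
  simpa [(one_sub_sq_pos hx).ne', (hpos x).ne', (sub_pos.2 hm).ne'] using h7

/-- The Rayleigh bound obtained from the test function `1 - x²`. -/
theorem le_integral (hp : Continuous p) (hpos : ∀ x, 0 < p x) (hl : 0 ≤ l)
    (hw : IsPositiveSolution p l w dw) :
    l ≤ 3 / 2 * (∫ x in (-1 : ℝ)..1, (1 - x ^ 2) * p x) ∧
      (l = 3 / 2 * (∫ x in (-1 : ℝ)..1, (1 - x ^ 2) * p x) →
        ∃ c : ℝ, ∀ x ∈ Ioo (-1 : ℝ) 1, p x = c) := by
  set I := ∫ x in (-1 : ℝ)..1, (1 - x ^ 2) * p x with hI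
  have hfc : Continuous fun x : ℝ => (1 - x ^ 2) * p x := by fun_prop
  have hIpos : 0 < I := by
    refine intervalIntegral.intervalIntegral_pos_of_pos_on (hfc.intervalIntegrable _ _)
      (fun x hx => mul_pos (one_sub_sq_pos hx) (hpos x)) (by norm_num)
  -- `1 / c` is the mean of `p` for the weight `1 - x²`. The tangent bound `1/p ≥ 2c - c² p`, which
  -- is `(1 - c p)² / p ≥ 0`, stands in for Cauchy–Schwarz, and this `c` is the optimal choice after
  -- integration.
  set c := 4 / 3 / I with hc
  have hcpos : 0 < c := by positivity
  -- `G` is what remains of Picone's derivative when the square is dropped and `1/p` is replaced by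
  -- its tangent bound; subtracting its primitive keeps the derivative nonnegative.
  set G : ℝ → ℝ := fun x => l * (2 * c * (1 - x ^ 2) - c ^ 2 * ((1 - x ^ 2) * p x)) -
    2 * (1 - x ^ 2) with hG
  have hGc : Continuous G := by fun_prop
  obtain ⟨h1, h2⟩ := tendsto_zero_of_abs_le fun x hx =>
    hw.abs_picone_le hpos hl (φ := fun x => 1 - x ^ 2) (dφ := fun x => -(2 * x)) (C := 1) (C' := 2)
      (fun x hx => by rw [abs_of_pos (one_sub_sq_pos hx), one_mul])
      (fun x hx => by rw [abs_neg, abs_le]; constructor <;> linarith [hx.1, hx.2]) hx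
  have hint : ∀ x, HasDerivAt (fun x => ∫ t in (-1 : ℝ)..x, G t) (G x) x := fun x =>
    (hGc.integral_hasStrictDerivAt _ _).hasDerivAt
  have hcont : Continuous fun x => ∫ t in (-1 : ℝ)..x, G t :=
    continuous_iff_continuousAt.2 fun x => (hint x).continuousAt
  have hA : ∫ x in (-1 : ℝ)..1, (1 - x ^ 2) = 4 / 3 := by
    rw [intervalIntegral.integral_sub (by simp) (by simp), integral_pow]
    norm_num
  have hGint : ∫ x in (-1 : ℝ)..1, G x = l * (16 / 9 / I) - 8 / 3 := by
    have hi : ∀ {g : ℝ → ℝ}, Continuous g → IntervalIntegrable g volume (-1) 1 :=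
      fun h => h.intervalIntegrable _ _
    rw [hG, intervalIntegral.integral_sub (hi (by fun_prop)) (hi (by fun_prop)),
      intervalIntegral.integral_const_mul, intervalIntegral.integral_const_mul,
      intervalIntegral.integral_sub (hi (by fun_prop)) (hi (by fun_prop)),
      intervalIntegral.integral_const_mul, intervalIntegral.integral_const_mul, hA, ← hI, hc]
    field_simp
    ring
  have hderiv : ∀ x ∈ Ioo (-1 : ℝ) 1, HasDerivAt
      (fun x => ((1 - x ^ 2) * -(2 * x) - (1 - x ^ 2) ^ 2 * (dw x / w x)) - ∫ t in (-1 : ℝ)..x, G t)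
      ((-(2 * x) - (1 - x ^ 2) * (dw x / w x)) ^ 2 +
        l * ((1 - x ^ 2) * (1 - c * p x) ^ 2 / p x)) x := fun x hx => by
    have h3 : HasDerivAt (fun x : ℝ => 1 - x ^ 2) (-(2 * x)) x := by
      simpa using (hasDerivAt_pow 2 x).const_sub 1
    have h4 : HasDerivAt (fun x : ℝ => -(2 * x)) (-2) x := by
      exact (((hasDerivAt_id x).const_mul 2).neg).congr_deriv (by simp)
    refine ((hw.hasDerivAt_picone (dφ := fun x => -(2 * x)) (ddφ := fun _ => -2) hx h3 h4).sub
      (hint x)).congr_deriv ?_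
    have h5 := (one_sub_sq_pos hx).ne'
    have h6 := (hpos x).ne'
    rw [hG]
    field_simp
    ring
  have hlim1 : Tendsto (fun x => ∫ t in (-1 : ℝ)..x, G t) (𝓝[>] (-1)) (𝓝 0) := by
    simpa using (hcont.tendsto (-1)).mono_left nhdsWithin_le_nhds
  have hlim2 := (hcont.tendsto 1).mono_left (nhdsWithin_le_nhds (s := Iio 1))
  have hnn : ∀ x ∈ Ioo (-1 : ℝ) 1, 0 ≤ l * ((1 - x ^ 2) * (1 - c * p x) ^ 2 / p x) := fun x hx => by
    have := one_sub_sq_pos hx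
    have := hpos x
    positivity
  obtain ⟨h3, h4⟩ := le_and_deriv_eq_zero_of_tendsto hderiv
    (fun x hx => add_nonneg (sq_nonneg _) (hnn x hx)) (h1.sub hlim1) (h2.sub hlim2)
  rw [hGint] at h3 h4
  refine ⟨?_, fun hl' => ⟨1 / c, fun x hx => ?_⟩⟩
  · have h5 : l * (16 / 9 / I) ≤ 8 / 3 := by linarith
    rw [← mul_div_assoc, div_le_iff₀ hIpos] at h5
    linarith
  · have h5 := h4 (by rw [hl']; field_simp; norm_num) x hx
    have h6 : l * ((1 - x ^ 2) * (1 - c * p x) ^ 2 / p x) = 0 := by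
      nlinarith [sq_nonneg (-(2 * x) - (1 - x ^ 2) * (dw x / w x)), hnn x hx]
    have hl0 : l ≠ 0 := by rw [hl']; positivity
    have h7 : 1 - c * p x = 0 := by
      simpa [hl0, (one_sub_sq_pos hx).ne', (hpos x).ne'] using h6
    rw [eq_div_iff hcpos.ne']
    linarith

end IsPositiveSolution

/-! ### Existence of a positive Dirichlet eigenfunction -/

lemma IsSturmLiouvilleSolution.reflect {p : ℝ → ℝ} {l : ℝ} {w dw : ℝ → ℝ}
    (h : IsSturmLiouvilleSolution (fun x => p (-x)) l w dw) :
    IsSturmLiouvilleSolution p l (fun x => w (-x)) (fun x => -dw (-x)) := by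
  intro x hx
  obtain ⟨h1, h2⟩ := h (-x) ⟨by linarith [hx.2], by linarith [hx.1]⟩
  constructor
  · exact (h1.scomp x (hasDerivAt_neg x)).congr_deriv (by simp)
  · have h3 := (h2.scomp x (hasDerivAt_neg x)).neg
    refine h3.congr_deriv ?_
    simp

lemma eq_const_of_hasDerivAt_zero {g : ℝ → ℝ} (hg : ∀ x ∈ Ioo (-1 : ℝ) 1, HasDerivAt g 0 x) :
    ∃ c, ∀ x ∈ Ioo (-1 : ℝ) 1, g x = c :=
  isOpen_Ioo.exists_is_const_of_deriv_eq_zero isPreconnected_Ioo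
    (fun x hx => (hg x hx).differentiableAt.differentiableWithinAt) fun x hx => (hg x hx).deriv

/-- Two solutions are proportional if their Wronskian tends to zero at `1`. -/
lemma IsSturmLiouvilleSolution.proportional {p : ℝ → ℝ} {l : ℝ} {w dw v dv : ℝ → ℝ}
    (hw : IsSturmLiouvilleSolution p l w dw) (hv : IsSturmLiouvilleSolution p l v dv)
    (hpos : ∀ x ∈ Ioo (-1 : ℝ) 1, 0 < w x)
    (hlim : Tendsto (fun x => w x * dv x - dw x * v x) (𝓝[<] 1) (𝓝 0)) :
    ∃ c, ∀ x ∈ Ioo (-1 : ℝ) 1, v x = c * w x := by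
  obtain ⟨b, hb⟩ := eq_const_of_hasDerivAt_zero (g := fun x => w x * dv x - dw x * v x)
    fun x hx => (((hw x hx).1.mul (hv x hx).2).sub ((hw x hx).2.mul (hv x hx).1)).congr_deriv
      (by ring)
  have hb0 : b = 0 := by
    refine tendsto_nhds_unique (tendsto_const_nhds.congr' ?_) hlim
    filter_upwards [Ioo_mem_nhdsLT (show (-1 : ℝ) < 1 by norm_num)] with x hx using (hb x hx).symm
  obtain ⟨c, hc⟩ := eq_const_of_hasDerivAt_zero (g := fun x => v x / w x) fun x hx => by
    refine ((hv x hx).1.div (hw x hx).1 (hpos x hx).ne').congr_deriv ?_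
    have := hb x hx
    rw [hb0] at this
    rw [div_eq_zero_iff]
    left; linarith
  exact ⟨c, fun x hx => by rw [← hc x hx, div_mul_cancel₀ _ (hpos x hx).ne']⟩

/-- A nonnegative solution with `w'(-1) = 1` is positive. -/
lemma IsSturmLiouvilleSolution.pos_of_nonneg {p : ℝ → ℝ} (hpos : ∀ x, 0 < p x) {l : ℝ} (hl : 0 ≤ l)
    {V : ℝ →ᵇ ℝ} {dw : ℝ → ℝ} (hs : IsSturmLiouvilleSolution p l (fun x => (1 + x) * V x) dw)
    (hV : ∀ x ∈ Ioo (-1 : ℝ) 1, 0 ≤ V x) (h1 : V (-1) = 1) {x : ℝ} (hx : x ∈ Ioo (-1 : ℝ) 1) :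
    0 < V x := by
  refine (hV x hx).lt_of_ne' fun h0 => ?_
  have hw : ∀ y ∈ Ioo (-1 : ℝ) 1, 0 ≤ (1 + y) * V y := fun y hy =>
    mul_nonneg (by linarith [hy.1]) (hV y hy)
  have hanti := IsPositiveSolution.antitoneOn hpos hl hs hw
  -- An interior zero is a minimum, so `w' = 0` there. By concavity `w' ≥ 0` to its left, which is
  -- impossible since `w` is positive near `-1` and falls to zero at `x`.
  have hmin : dw x = 0 := by
    refine IsLocalMin.hasDerivAt_eq_zero ?_ (hs x hx).1
    filter_upwards [Ioo_mem_nhds hx.1 hx.2] with y hy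
    simpa [h0] using hw y hy
  obtain ⟨y, hy1, hy2⟩ : ∃ y, 0 < V y ∧ y ∈ Ioo (-1) x := by
    have h2 : ∀ᶠ y in 𝓝 (-1), 0 < V y :=
      V.continuous.continuousAt.eventually_const_lt (by rw [h1]; exact one_pos)
    exact ((h2.filter_mono nhdsWithin_le_nhds).and (Ioo_mem_nhdsGT hx.1)).exists
  obtain ⟨c, hc, hc'⟩ := exists_hasDerivAt_eq_slope (fun x => (1 + x) * V x) dw hy2.2
    (by have := V.continuous; fun_prop)
    fun t ht => (hs t ⟨hy2.1.trans ht.1, ht.2.trans hx.2⟩).1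
  have h3 := hanti ⟨hy2.1.trans hc.1, hc.2.trans hx.2⟩ hx hc.2.le
  rw [hmin, hc', h0, mul_zero, zero_sub, le_div_iff₀ (sub_pos.2 hy2.2)] at h3
  have h4 : 0 < (1 + y) * V y := mul_pos (by linarith [hy2.1]) hy1
  linarith

/-- The first eigenvalue and its positive eigenfunction. -/
theorem exists_positive_eigenfunction {p : ℝ → ℝ} (hp : Continuous p) (hpos : ∀ x, 0 < p x) :
    ∃ (l : ℝ) (z dw : ℝ → ℝ), 0 < l ∧ Continuous z ∧ (∀ x ∈ Ioo (-1 : ℝ) 1, 0 < z x) ∧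
      IsSturmLiouvilleSolution p l (fun x => (1 - x ^ 2) * z x) dw := by
  obtain ⟨V, D, hVc, hV0, hV⟩ := exists_shooting hp hpos
  have hfac : ∀ x ∈ Ioo (-1 : ℝ) 1, 0 < 1 + x := fun x hx => by linarith [hx.1]
  have hpsol : ∀ l, (∀ x ∈ Ioo (-1 : ℝ) 1, 0 < V l x) →
      IsPositiveSolution p l (fun x => (1 + x) * V l x) (D l) := fun l h =>
    { sol := (hV l).2.2
      continuousOn := by have := (V l).continuous; fun_prop
      pos := fun x hx => mul_pos (hfac x hx) (h x hx)
      left := by simp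
      right := by
        refine mul_nonneg (by norm_num) (ge_of_tendsto
          (((V l).continuous.tendsto 1).mono_left (nhdsWithin_le_nhds (s := Iio 1))) ?_)
        filter_upwards [Ioo_mem_nhdsLT (show (-1 : ℝ) < 1 by norm_num)] with x hx using (h x hx).le }
  -- The parameters whose shooting solution has no interior zero. The Rayleigh bound applies to each
  -- of them, so it bounds `P` above, and the supremum will be the eigenvalue.
  set P : Set ℝ := {l | 0 ≤ l ∧ ∀ x ∈ Ioo (-1 : ℝ) 1, 0 < V l x} with hP
  have hbdd : BddAbove P := ⟨_, fun l hl => ((hpsol l hl.2).le_integral hp hpos hl.1).1⟩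
  have h0P : (0 : ℝ) ∈ P := ⟨le_rfl, fun x hx => by rw [hV0 x ⟨hx.1.le, hx.2.le⟩]; exact one_pos⟩
  set L := sSup P
  have hLP : L ∈ P := by
    have h1 : IsClosed {l | 0 ≤ l ∧ ∀ x ∈ Ioo (-1 : ℝ) 1, 0 ≤ V l x} := by
      simp only [ofPred_and, ofPred_forall]
      refine isClosed_Ici.inter (isClosed_biInter fun x _ => isClosed_le continuous_const ?_)
      exact (continuous_eval_const x).comp hVc
    have hsub : P ⊆ {l | 0 ≤ l ∧ ∀ x ∈ Ioo (-1 : ℝ) 1, 0 ≤ V l x} :=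
      fun l hl => ⟨hl.1, fun x hx => (hl.2 x hx).le⟩
    obtain ⟨h2, h3⟩ := closure_minimal hsub h1 (csSup_mem_closure ⟨0, h0P⟩ hbdd)
    exact ⟨h2, fun x hx => (hV L).2.2.pos_of_nonneg hpos h2 h3 (hV L).1 hx⟩
  have hps := hpsol L hLP.2
  -- If `V L` were positive at `1` too, it would have a positive minimum on `[-1, 1]`, and sup-norm
  -- continuity in `l` would put a parameter larger than `L` in `P`.
  have hL1 : V L 1 = 0 := by
    by_contra hne
    have h1 : 0 < V L 1 := by
      have := hps.right
      refine lt_of_le_of_ne ?_ (Ne.symm hne)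
      norm_num at this
      exact this
    have h2 : ∀ x ∈ Icc (-1 : ℝ) 1, 0 < V L x := fun x hx => by
      rcases hx.1.eq_or_lt with rfl | h
      · rw [(hV L).1]; exact one_pos
      rcases hx.2.eq_or_lt with rfl | h'
      · exact h1
      exact hLP.2 x ⟨h, h'⟩
    obtain ⟨x₀, hx₀, hmin⟩ := (isCompact_Icc (a := (-1 : ℝ)) (b := 1)).exists_isMinOn
      (nonempty_Icc.2 (by norm_num)) (V L).continuous.continuousOn
    obtain ⟨δ, hδ, hδ'⟩ := Metric.continuous_iff.1 hVc L (V L x₀) (h2 x₀ hx₀)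
    have h3 : L + δ / 2 ∈ P := by
      refine ⟨by linarith [hLP.1], fun x hx => ?_⟩
      have h4 := hδ' (L + δ / 2) (by simp [abs_of_pos hδ, hδ])
      have h5 := (BoundedContinuousFunction.dist_coe_le_dist x).trans_lt h4
      have h6 : V L x₀ ≤ V L x := hmin ⟨hx.1.le, hx.2.le⟩
      rw [Real.dist_eq, abs_lt] at h5
      linarith
    linarith [le_csSup hbdd h3]
  have hL0 : 0 < L := by
    refine hLP.1.lt_of_ne fun h => ?_
    rw [← h, hV0 1 (by simp)] at hL1
    exact one_ne_zero hL1
  -- Vanishing at `1` does not yet show that `w / (1 - x)` is continuous there. Shooting from the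
  -- right end, by reflection, gives a solution with this property; the Wronskian of the two tends
  -- to zero at `1`, so they are proportional.
  obtain ⟨V', D', -, -, hV'⟩ := exists_shooting (p := fun x => p (-x)) (by fun_prop)
    fun x => hpos (-x)
  obtain ⟨h1, h2, h3⟩ := hV' L
  have h3' := h3.reflect
  have hVL := (V L).continuous
  have hVL' := (V' L).continuous
  obtain ⟨c, hc⟩ := hps.sol.proportional h3' hps.pos (by
    have hA : Tendsto (fun x => (1 + x) * V L x * -D' L (-x)) (𝓝[<] 1) (𝓝 0) := by
      have hD : ContinuousAt (fun x => D' L (-x)) 1 :=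
        (h2.continuousAt (Iio_mem_nhds (by norm_num))).comp (f := fun x : ℝ => -x) (by fun_prop)
      have : ContinuousAt (fun x => (1 + x) * V L x * -D' L (-x)) 1 :=
        (by fun_prop : Continuous fun x => (1 + x) * V L x).continuousAt.mul hD.neg
      simpa [hL1] using this.tendsto.mono_left (nhdsWithin_le_nhds (s := Iio 1))
    have hB : Tendsto (fun x => D L x * ((1 + -x) * V' L (-x))) (𝓝[<] 1) (𝓝 0) := by
      have hC : Tendsto (fun x => 2 * |V L x * V' L (-x)|) (𝓝[<] 1) (𝓝 0) := by
        have : Continuous fun x => 2 * |V L x * V' L (-x)| := by fun_prop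
        simpa [hL1] using (this.tendsto 1).mono_left (nhdsWithin_le_nhds (s := Iio 1))
      refine squeeze_zero_norm' ?_ hC
      filter_upwards [Ioo_mem_nhdsLT (show (-1 : ℝ) < 1 by norm_num)] with x hx
      have h4 := hps.abs_logDeriv_le hpos hLP.1 hx
      have h5 := (hfac x hx).ne'
      have h6 := (hLP.2 x hx).ne'
      have h7 : D L x * ((1 + -x) * V' L (-x)) =
          (1 - x ^ 2) * (D L x / ((1 + x) * V L x)) * (V L x * V' L (-x)) := by
        field_simp
        ring
      rw [h7, norm_mul]
      exact mul_le_mul_of_nonneg_right h4 (norm_nonneg _)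
    simpa using hA.sub hB)
  have hc0 : c ≠ 0 := by
    rintro rfl
    have h4 : Tendsto (fun x => V' L (-x)) (𝓝[<] 1) (𝓝 1) := by
      have : Continuous fun x => V' L (-x) := by fun_prop
      simpa [h1] using (this.tendsto 1).mono_left (nhdsWithin_le_nhds (s := Iio 1))
    have h5 : Tendsto (fun x => V' L (-x)) (𝓝[<] 1) (𝓝 0) := by
      refine tendsto_const_nhds.congr' ?_
      filter_upwards [Ioo_mem_nhdsLT (show (-1 : ℝ) < 1 by norm_num)] with x hx
      have h6 := hc x hx
      have h7 : 1 + -x ≠ 0 := by linarith [hx.2]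
      simpa [h7, eq_comm] using h6
    exact one_ne_zero (tendsto_nhds_unique h4 h5)
  -- If `w = (1 - x²) z`, then `V L x = (1 - x) z` and `c⁻¹ V' L (-x) = (1 + x) z`. Their average is
  -- `z`, a formula which is continuous without any division.
  have hz : ∀ x ∈ Ioo (-1 : ℝ) 1,
      (1 - x ^ 2) * ((V L x + c⁻¹ * V' L (-x)) / 2) = (1 + x) * V L x := fun x hx => by
    have h6 := hc x hx
    have h7 : c⁻¹ * ((1 + -x) * V' L (-x)) = (1 + x) * V L x := by
      rw [h6]; field_simp
    linear_combination (1 + x) / 2 * h7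
  refine ⟨L, fun x => (V L x + c⁻¹ * V' L (-x)) / 2, D L, hL0, by fun_prop, fun x hx => ?_,
    fun x hx => ⟨?_, ?_⟩⟩
  · have h4 := hps.pos x hx
    rw [← hz x hx] at h4
    exact (mul_pos_iff_of_pos_left (one_sub_sq_pos hx)).1 h4
  · refine (hps.sol x hx).1.congr_of_eventuallyEq ?_
    filter_upwards [Ioo_mem_nhds hx.1 hx.2] with y hy using hz y hy
  · simp only [hz x hx]
    exact (hps.sol x hx).2

/-! ### Smoothness up to the end points -/

lemma contDiff_succ_of_hasDerivAt {k : ℕ} {G G' : ℝ → ℝ} (h : ∀ x, HasDerivAt G (G' x) x)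
    (hG' : ContDiff ℝ k G') : ContDiff ℝ (k + 1 : ℕ) G := by
  push_cast
  refine contDiff_succ_iff_deriv.2 ⟨fun x => (h x).differentiableAt, by simp, ?_⟩
  rwa [show deriv G = G' from funext fun x => (h x).deriv]

/-- Each differentiation under the integral sign brings out a factor `s`, so the induction on `k`
needs all the weights `s ^ m`; Hadamard's lemma uses only `m = 0`. -/
lemma contDiff_integral_average {k : ℕ} (a : ℝ) {G : ℝ → ℝ} (hG : ContDiff ℝ k G) (m : ℕ) :
    ContDiff ℝ k fun x => ∫ s in (0 : ℝ)..1, s ^ m * G (a + s * (x - a)) := by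
  induction k generalizing G m with
  | zero =>
    have := hG.continuous
    refine contDiff_zero.2 (intervalIntegral.continuous_parametric_intervalIntegral_of_continuous' ?_ _ _)
    simp only [Function.uncurry_def]
    fun_prop
  | succ k ih =>
    have hG0 := hG.continuous
    push_cast at hG
    obtain ⟨hd, -, hG1⟩ := contDiff_succ_iff_deriv.1 hG
    have hG1c := hG1.continuous
    refine contDiff_succ_of_hasDerivAt (fun x => ?_) (ih hG1 (m + 1))
    obtain ⟨B, hB⟩ := ((isCompact_Icc (a := (0 : ℝ)) (b := 1)).prod
      (isCompact_closedBall x 1)).exists_bound_of_continuousOn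
      (f := fun q : ℝ × ℝ => q.1 ^ (m + 1) * deriv G (a + q.1 * (q.2 - a))) (by fun_prop)
    refine (intervalIntegral.hasDerivAt_integral_of_dominated_loc_of_deriv_le
      (F' := fun x s => s ^ (m + 1) * deriv G (a + s * (x - a))) (bound := fun _ => B)
      (Metric.ball_mem_nhds x one_pos) (Eventually.of_forall fun y => ?_) ?_ ?_ ?_ (by simp) ?_).2
    · exact Continuous.aestronglyMeasurable (by fun_prop)
    · exact Continuous.intervalIntegrable (by fun_prop) _ _
    · exact Continuous.aestronglyMeasurable (by fun_prop)
    · refine Eventually.of_forall fun s hs y hy => hB (s, y) ⟨?_, Metric.ball_subset_closedBall hy⟩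
      rw [uIoc_of_le zero_le_one] at hs
      exact ⟨hs.1.le, hs.2⟩
    · refine Eventually.of_forall fun s _ y _ => ?_
      have h1 : HasDerivAt (fun y => a + s * (y - a)) s y := by
        simpa using (((hasDerivAt_id y).sub_const a).const_mul s).const_add a
      refine (((hd (a + s * (y - a))).hasDerivAt.comp y h1).const_mul (s ^ m)).congr_deriv ?_
      ring

/-- Hadamard's lemma in one variable. -/
lemma exists_contDiff_factor {k : ℕ} (a : ℝ) {G : ℝ → ℝ} (hG : ContDiff ℝ (k + 1 : ℕ) G) :
    ∃ Q, ContDiff ℝ k Q ∧ ∀ x, G x - G a = (x - a) * Q x := by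
  push_cast at hG
  obtain ⟨hd, -, hG1⟩ := contDiff_succ_iff_deriv.1 hG
  have hG1c := hG1.continuous
  refine ⟨_, contDiff_integral_average a hG1 0, fun x => ?_⟩
  have h1 : ∀ s ∈ uIcc (0 : ℝ) 1, HasDerivAt (fun s => G (a + s * (x - a)))
      ((x - a) * (s ^ 0 * deriv G (a + s * (x - a)))) s := fun s _ => by
    have h2 : HasDerivAt (fun s => a + s * (x - a)) (x - a) s := by
      simpa using ((hasDerivAt_id s).mul_const (x - a)).const_add a
    refine ((hd (a + s * (x - a))).hasDerivAt.comp s h2).congr_deriv ?_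
    ring
  rw [← intervalIntegral.integral_const_mul, intervalIntegral.integral_eq_sub_of_hasDerivAt h1
    (Continuous.intervalIntegrable (by fun_prop) _ _)]
  simp

lemma contDiffOn_succ_antideriv {k : ℕ} {g G : ℝ → ℝ} (hg : ContDiffOn ℝ k g (Icc (-1) 1))
    (hG : ∀ x, HasDerivAt G (g (clamp x)) x) : ContDiffOn ℝ (k + 1 : ℕ) G (Icc (-1) 1) := by
  have hu := uniqueDiffOn_Icc (show (-1 : ℝ) < 1 by norm_num)
  push_cast
  refine (contDiffOn_succ_iff_derivWithin hu).2
    ⟨fun x _ => (hG x).differentiableAt.differentiableWithinAt, by simp, hg.congr fun x hx => ?_⟩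
  rw [(hG x).hasDerivWithinAt.derivWithin (hu x hx), clamp_of_mem hx]

lemma exists_antideriv {g : ℝ → ℝ} (hg : ContinuousOn g (Icc (-1) 1)) :
    ∃ G : ℝ → ℝ, ∀ x, HasDerivAt G (g (clamp x)) x := by
  have h : Continuous fun x => g (clamp x) :=
    hg.comp_continuous continuous_clamp clamp_mem
  exact ⟨_, fun x => (h.integral_hasStrictDerivAt 0 x).hasDerivAt⟩

/-- Extend the derivative and integrate; in degree zero, extend by constants. Hadamard's lemma can
then be used for functions given only on `[-1, 1]`. -/
lemma exists_contDiff_extension {k : ℕ} {g : ℝ → ℝ} (hg : ContDiffOn ℝ k g (Icc (-1) 1)) :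
    ∃ G, ContDiff ℝ k G ∧ EqOn g G (Icc (-1) 1) := by
  induction k generalizing g with
  | zero =>
    refine ⟨fun x => g (clamp x), contDiff_zero.2
      (hg.continuousOn.comp_continuous continuous_clamp clamp_mem), fun x hx => ?_⟩
    simp only [clamp_of_mem hx]
  | succ k ih =>
    have hu := uniqueDiffOn_Icc (show (-1 : ℝ) < 1 by norm_num)
    push_cast at hg
    obtain ⟨hd, -, hg1⟩ := (contDiffOn_succ_iff_derivWithin hu).1 hg
    obtain ⟨G₁, hG₁, heq⟩ := ih hg1
    have hder : ∀ x, HasDerivAt (fun x => g (-1) + ∫ t in (-1 : ℝ)..x, G₁ t) (G₁ x) x := fun x =>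
      ((hG₁.continuous.integral_hasStrictDerivAt _ x).hasDerivAt).const_add _
    refine ⟨_, contDiff_succ_of_hasDerivAt hder hG₁, ?_⟩
    refine eq_of_derivWithin_eq hd (fun x _ => (hder x).differentiableAt.differentiableWithinAt)
      (fun x hx => ?_) (by simp)
    have hx' := Ico_subset_Icc_self hx
    rw [(hder x).hasDerivWithinAt.derivWithin (hu x hx'), heq hx']

lemma Icc_subset_closure_Ioo : Icc (-1 : ℝ) 1 ⊆ closure (Ioo (-1) 1) := by
  rw [closure_Ioo (by norm_num)]

/-- Division by `1 - x²` costs one derivative. -/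
lemma contDiffOn_of_mul_one_sub_sq {k : ℕ} {w z : ℝ → ℝ}
    (hw : ContDiffOn ℝ (k + 1 : ℕ) w (Icc (-1) 1)) (hz : ContinuousOn z (Icc (-1) 1))
    (h : ∀ x ∈ Icc (-1 : ℝ) 1, w x = (1 - x ^ 2) * z x) : ContDiffOn ℝ k z (Icc (-1) 1) := by
  obtain ⟨W, hW, heq⟩ := exists_contDiff_extension hw
  obtain ⟨Q₁, hQ₁, h1⟩ := exists_contDiff_factor (-1) hW
  obtain ⟨Q₂, hQ₂, h2⟩ := exists_contDiff_factor 1 hW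
  have hl : W (-1) = 0 := by rw [← heq (by simp), h _ (by simp)]; simp
  have hr : W 1 = 0 := by rw [← heq (by simp), h _ (by simp)]; simp
  -- Partial fractions: `1 / (1 - x²)` is half of `1 / (1 + x) + 1 / (1 - x)`, and `Q₁`, `Q₂` are
  -- the quotients of `W` by `x + 1` and `x - 1`.
  have hQ : ContDiff ℝ k fun x => (Q₁ x - Q₂ x) / 2 := (hQ₁.sub hQ₂).div_const 2
  refine hQ.contDiffOn.congr (EqOn.of_subset_closure (s := Ioo (-1) 1) (fun x hx => ?_) hz
    hQ.continuous.continuousOn Ioo_subset_Icc_self Icc_subset_closure_Ioo)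
  have h3 := h1 x
  have h4 := h2 x
  have hx' := Ioo_subset_Icc_self hx
  rw [hl, ← heq hx', h x hx'] at h3
  rw [hr, ← heq hx', h x hx'] at h4
  have h5 : 1 + x ≠ 0 := by linarith [hx.1]
  have h6 : 1 - x ≠ 0 := by linarith [hx.2]
  have h7 : (1 - x) * z x = Q₁ x := mul_left_cancel₀ h5 (by linear_combination h3)
  have h8 : (1 + x) * z x = -Q₂ x := mul_left_cancel₀ h6 (by linear_combination h4)
  linear_combination (h7 + h8) / 2

lemma eqOn_add_const {g G : ℝ → ℝ} {d : ℝ → ℝ} (hg : ∀ x ∈ Ioo (-1 : ℝ) 1, HasDerivAt g (d x) x)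
    (hG : ∀ x ∈ Ioo (-1 : ℝ) 1, HasDerivAt G (d x) x) :
    ∃ c, ∀ x ∈ Ioo (-1 : ℝ) 1, g x = G x + c := by
  obtain ⟨c, hc⟩ := eq_const_of_hasDerivAt_zero (g := fun x => g x - G x)
    fun x hx => ((hg x hx).sub (hG x hx)).congr_deriv (sub_self _)
  exact ⟨c, fun x hx => by linarith [hc x hx]⟩

/-- Eigenfunctions are smooth up to the end points. -/
theorem IsSturmLiouvilleSolution.contDiffOn {p : ℝ → ℝ} (hp : ContDiffOn ℝ ∞ p (Icc (-1) 1))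
    (hpos : ∀ x, 0 < p x) {l : ℝ} {z dw : ℝ → ℝ} (hz : Continuous z)
    (hs : IsSturmLiouvilleSolution p l (fun x => (1 - x ^ 2) * z x) dw) :
    ∃ y, ContDiffOn ℝ ∞ y (Icc (-1) 1) ∧ ∀ x ∈ Ioo (-1 : ℝ) 1, dw x = y x := by
  have hg : ∀ {k : ℕ}, ContDiffOn ℝ k z (Icc (-1) 1) →
      ContDiffOn ℝ k (fun x => -(l * z x / p x)) (Icc (-1) 1) := fun h =>
    ((contDiffOn_const.mul h).div (hp.of_le (mod_cast le_top)) fun x _ => (hpos x).ne').neg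
  have hz0 : ContDiffOn ℝ (0 : ℕ) z (Icc (-1) 1) := contDiffOn_zero.2 hz.continuousOn
  obtain ⟨G, hG⟩ := exists_antideriv (hg hz0).continuousOn
  obtain ⟨c, hc⟩ := eqOn_add_const (g := dw) (G := G) (d := fun x => -(l * z x / p x))
    (fun x hx => (hs x hx).2.congr_deriv (by
      rw [mul_left_comm, mul_div_mul_left _ _ (one_sub_sq_pos hx).ne']))
    fun x hx => (hG x).congr_deriv (by simp only [clamp_of_mem (Ioo_subset_Icc_self hx)])
  have hy : ∀ {k : ℕ}, ContDiffOn ℝ k z (Icc (-1) 1) →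
      ContDiffOn ℝ (k + 1 : ℕ) (fun x => G x + c) (Icc (-1) 1) := fun h =>
    (contDiffOn_succ_antideriv (hg h) hG).add contDiffOn_const
  obtain ⟨H, hH⟩ := exists_antideriv (hy hz0).continuousOn
  obtain ⟨c', hc'⟩ := eqOn_add_const (g := fun x => (1 - x ^ 2) * z x) (G := H) (d := dw)
    (fun x hx => (hs x hx).1) fun x hx => (hH x).congr_deriv (by
      simp only [clamp_of_mem (Ioo_subset_Icc_self hx), hc x hx])
  have hHc : Continuous H := continuous_iff_continuousAt.2 fun x => (hH x).continuousAt
  have heq : EqOn (fun x => (1 - x ^ 2) * z x) (fun x => H x + c') (Icc (-1) 1) :=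
    EqOn.of_subset_closure (s := Ioo (-1) 1) hc' (by fun_prop) (by fun_prop) Ioo_subset_Icc_self
      Icc_subset_closure_Ioo
  -- Bootstrap: if `z` is `C^k`, so is `w'' = -l z / p`. Two integrations make `w` of class
  -- `C^(k+2)`, and division by `1 - x²` loses one order, so `z` is `C^(k+1)`.
  have hzk : ∀ k : ℕ, ContDiffOn ℝ k z (Icc (-1) 1) := fun k => by
    induction k with
    | zero => exact hz0
    | succ k ih =>
      refine contDiffOn_of_mul_one_sub_sq (w := fun x => H x + c') ?_ hz.continuousOn
        fun x hx => (heq hx).symm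
      exact (contDiffOn_succ_antideriv (hy ih) hH).add contDiffOn_const
  exact ⟨_, contDiffOn_infty.2 fun k => (hy (hzk k)).of_le (mod_cast k.le_succ), hc⟩

/-- A profile function is `1 - x²` times a positive smooth function. -/
theorem exists_profile_factor {f : ℝ → ℝ} (hf : ContDiffOn ℝ ∞ f (Icc (-1) 1))
    (hpos : ∀ x ∈ Ioo (-1 : ℝ) 1, 0 < f x) (hl : f (-1) = 0) (hr : f 1 = 0)
    (hdl : HasDerivWithinAt f 2 (Icc (-1) 1) (-1))
    (hdr : HasDerivWithinAt f (-2) (Icc (-1) 1) 1) :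
    ∃ p : ℝ → ℝ, Continuous p ∧ (∀ x, 0 < p x) ∧ ContDiffOn ℝ ∞ p (Icc (-1) 1) ∧
      p 1 = 1 ∧ ∀ x ∈ Icc (-1 : ℝ) 1, f x = (1 - x ^ 2) * p x := by
  classical
  -- The value one at `±1` is dictated by `f'(-1) = 2` and `f'(1) = -2`.
  set p : ℝ → ℝ := fun x => if x ∈ Ioo (-1 : ℝ) 1 then f x / (1 - x ^ 2) else 1 with hp
  have hpin : ∀ x ∈ Ioo (-1 : ℝ) 1, p x = f x / (1 - x ^ 2) := fun x hx => if_pos hx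
  have hpl : p (-1) = 1 := if_neg (by simp)
  have hpr : p 1 = 1 := if_neg (by simp)
  have hfp : ∀ x ∈ Icc (-1 : ℝ) 1, f x = (1 - x ^ 2) * p x := fun x hx => by
    rcases hx.1.eq_or_lt with rfl | h
    · simp [hl]
    rcases hx.2.eq_or_lt with rfl | h'
    · simp [hr]
    rw [hpin x ⟨h, h'⟩, mul_div_cancel₀ _ (one_sub_sq_pos ⟨h, h'⟩).ne']
  obtain ⟨F, hF, heq⟩ := exists_contDiff_extension (k := 2) (contDiffOn_infty.1 hf 2)
  obtain ⟨Q₁, hQ₁, h1⟩ := exists_contDiff_factor (k := 1) (-1) hF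
  obtain ⟨Q₂, hQ₂, h2⟩ := exists_contDiff_factor (k := 1) 1 hF
  have hFl : F (-1) = 0 := by rw [← heq (by simp), hl]
  have hFr : F 1 = 0 := by rw [← heq (by simp), hr]
  rw [hFl] at h1
  rw [hFr] at h2
  have hu := uniqueDiffOn_Icc (show (-1 : ℝ) < 1 by norm_num)
  -- The Hadamard quotient at an end point is the one-sided derivative of `f`.
  have hval : ∀ {a d : ℝ} {Q : ℝ → ℝ}, a ∈ Icc (-1 : ℝ) 1 → ContDiff ℝ (1 : ℕ) Q →
      HasDerivWithinAt f d (Icc (-1) 1) a → (∀ x, F x - 0 = (x - a) * Q x) → Q a = d := by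
    intro a d Q ha hQ hd h
    have h3 := ((hasDerivAt_id a).sub_const a).mul
      ((hQ.differentiable (by simp)) a).hasDerivAt
    have h4 : HasDerivWithinAt f (Q a) (Icc (-1) 1) a := by
      refine (h3.hasDerivWithinAt.congr_deriv (by simp)).congr (fun x hx => ?_) ?_
      · rw [heq hx]; simpa using h x
      · rw [heq ha]; simpa using h a
    exact (hu a ha).eq_deriv _ h4 hd
  have hQ1l := hval (by simp) hQ₁ hdl h1
  have hQ2r := hval (by simp) hQ₂ hdr h2
  have hQ1r : Q₁ 1 = 0 := by have := h1 1; rw [hFr] at this; linarith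
  have hQ2l : Q₂ (-1) = 0 := by have := h2 (-1); rw [hFl] at this; linarith
  have hpQ : ∀ x ∈ Icc (-1 : ℝ) 1, p x = (Q₁ x - Q₂ x) / 2 := fun x hx => by
    rcases hx.1.eq_or_lt with rfl | h
    · rw [hpl, hQ1l, hQ2l]; norm_num
    rcases hx.2.eq_or_lt with rfl | h'
    · rw [hpr, hQ1r, hQ2r]; norm_num
    have h3 := h1 x
    have h4 := h2 x
    rw [← heq hx, hfp x hx] at h3 h4
    have h5 : 1 + x ≠ 0 := by linarith
    have h6 : 1 - x ≠ 0 := by linarith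
    have h7 : (1 - x) * p x = Q₁ x := mul_left_cancel₀ h5 (by linear_combination h3)
    have h8 : (1 + x) * p x = -Q₂ x := mul_left_cancel₀ h6 (by linear_combination h4)
    linear_combination (h7 + h8) / 2
  have hpc : ContinuousOn p (Icc (-1) 1) := by
    have h3 := hQ₁.continuous
    have h4 := hQ₂.continuous
    exact ContinuousOn.congr (f := fun x => (Q₁ x - Q₂ x) / 2) (by fun_prop) hpQ
  refine ⟨p, ?_, fun x => ?_, ?_, hpr, hfp⟩
  · have h3 : p = fun x => p (clamp x) := funext fun x => by
      rcases lt_or_ge x (-1) with h | h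
      · rw [show clamp x = -1 from max_eq_left (min_le_of_left_le h.le), hpl]
        exact if_neg fun h' => by linarith [h'.1]
      rcases lt_or_ge 1 x with h' | h'
      · rw [show clamp x = 1 by simp [clamp, min_eq_right h'.le], hpr]
        exact if_neg fun h'' => by linarith [h''.2]
      rw [clamp_of_mem ⟨h, h'⟩]
    rw [h3]
    exact hpc.comp_continuous continuous_clamp clamp_mem
  · by_cases hx : x ∈ Ioo (-1 : ℝ) 1
    · rw [hpin x hx]
      exact div_pos (hpos x hx) (one_sub_sq_pos hx)
    · rw [hp]; simp only [if_neg hx]; exact one_pos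
  · exact contDiffOn_infty.2 fun k =>
      contDiffOn_of_mul_one_sub_sq (hf.of_le (mod_cast le_top)) hpc hfp

/-! ### Coordinates on the sphere -/

lemma fact_finrank_three : Fact (Module.finrank ℝ (EuclideanSpace ℝ (Fin 3)) = 2 + 1) := ⟨by simp⟩

lemma contMDiff_coe_S2 :
    ContMDiff (𝓡 2) 𝓘(ℝ, EuclideanSpace ℝ (Fin 3)) ∞ (fun q : S2 => (q : EuclideanSpace ℝ (Fin 3))) :=
  haveI := fact_finrank_three
  contMDiff_coe_sphere (n := 2)

lemma mfderiv_coe_S2_injective (q : S2) :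
    Function.Injective (mfderiv (𝓡 2) 𝓘(ℝ, EuclideanSpace ℝ (Fin 3))
      (fun q : S2 => (q : EuclideanSpace ℝ (Fin 3))) q) := by
  have := fact_finrank_three
  convert! injective_mvfderiv_subtypeVal_sphere (n := 2) q

lemma contMDiff_codRestrict_S2 {E : Type*} [NormedAddCommGroup E] [NormedSpace ℝ E]
    {F : E → EuclideanSpace ℝ (Fin 3)} (hF : ContDiff ℝ ∞ F)
    (hF' : ∀ x, F x ∈ Metric.sphere (0 : EuclideanSpace ℝ (Fin 3)) 1) :
    ContMDiff 𝓘(ℝ, E) (𝓡 2) ∞ (fun x => (⟨F x, hF' x⟩ : S2)) :=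
  haveI := fact_finrank_three
  (contMDiff_iff_contDiff.2 hF).codRestrict_sphere (n := 2) hF'

lemma norm_polar_vec (s θ : ℝ) :
    !₂[sin s * cos θ, sin s * sin θ, cos s] ∈ Metric.sphere (0 : EuclideanSpace ℝ (Fin 3)) 1 := by
  have h1 : ‖!₂[sin s * cos θ, sin s * sin θ, cos s]‖ ^ 2 = 1 := by
    rw [EuclideanSpace.norm_sq_eq]
    simp only [Fin.sum_univ_three, Real.norm_eq_abs, sq_abs]
    simp only [Matrix.cons_val_zero, Matrix.cons_val_one, Matrix.cons_val]
    linear_combination sin s ^ 2 * sin_sq_add_cos_sq θ + sin_sq_add_cos_sq s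
  rw [mem_sphere_zero_iff_norm]
  exact (sq_eq_sq₀ (norm_nonneg _) zero_le_one).mp (by rw [h1, one_pow])

/-- The point of `S²` with colatitude `s` and longitude `θ`. -/
noncomputable def polarPoint (s θ : ℝ) : S2 :=
  ⟨!₂[sin s * cos θ, sin s * sin θ, cos s], norm_polar_vec s θ⟩

/-- Polar coordinates parametrize the sphere smoothly even through the poles, so all failure of
smoothness of the cylinder coordinates on `[-1, 1]` is confined to `arccos`. -/
lemma cylinderPoint_eq_polarPoint {x : ℝ} (hx : x ∈ Icc (-1 : ℝ) 1) (θ : ℝ) :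
    cylinderPoint x θ = polarPoint (arccos x) θ := by
  have h : (projIcc (-1 : ℝ) 1 (by norm_num) x : ℝ) = x := by rw [projIcc_of_mem _ hx]
  simp only [cylinderPoint, polarPoint, h, sin_arccos, cos_arccos hx.1 hx.2]

lemma contMDiff_polarPoint :
    ContMDiff 𝓘(ℝ, ℝ × ℝ) (𝓡 2) ∞ (fun q : ℝ × ℝ => polarPoint q.1 q.2) := by
  have h : ContDiff ℝ ∞ fun q : ℝ × ℝ =>
      !₂[sin q.1 * cos q.2, sin q.1 * sin q.2, cos q.1] := by
    refine contDiff_euclidean.2 fun i => ?_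
    fin_cases i <;> simp <;> fun_prop
  exact contMDiff_codRestrict_S2 h fun q => norm_polar_vec q.1 q.2

lemma cylinderPoint_two {x : ℝ} (hx : x ∈ Icc (-1 : ℝ) 1) (θ : ℝ) :
    (cylinderPoint x θ : EuclideanSpace ℝ (Fin 3)) 2 = x := by
  simp [cylinderPoint, projIcc_of_mem _ hx]

lemma exists_eq_cylinderPoint (q : S2) :
    ∃ x ∈ Icc (-1 : ℝ) 1, ∃ θ, q = cylinderPoint x θ := by
  obtain ⟨v, hv⟩ := q
  have h1 : v 0 ^ 2 + v 1 ^ 2 + v 2 ^ 2 = 1 := by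
    have h2 : ‖v‖ ^ 2 = 1 := by rw [mem_sphere_zero_iff_norm.1 hv, one_pow]
    rw [EuclideanSpace.norm_sq_eq] at h2
    simpa [Fin.sum_univ_three] using h2
  have hx : v 2 ∈ Icc (-1 : ℝ) 1 := by constructor <;> nlinarith [sq_nonneg (v 0), sq_nonneg (v 1)]
  set ζ : ℂ := ⟨v 0, v 1⟩
  have h3 : √(1 - v 2 ^ 2) = ‖ζ‖ := by
    rw [Complex.norm_def, Complex.normSq_mk]
    congr 1
    linarith
  refine ⟨v 2, hx, Complex.arg ζ, Subtype.ext ?_⟩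
  ext i
  have h4 : (projIcc (-1 : ℝ) 1 (by norm_num) (v 2) : ℝ) = v 2 := by rw [projIcc_of_mem _ hx]
  fin_cases i
  · simp [cylinderPoint, h4, h3, Complex.norm_mul_cos_arg, ζ]
  · simp [cylinderPoint, h4, h3, Complex.norm_mul_sin_arg, ζ]
  · simp [cylinderPoint, h4]

/-! ### Invariant eigenfunctions and the ordinary differential equation -/

section

variable {M : Type*} [TopologicalSpace M] [ChartedSpace (EuclideanSpace ℝ (Fin 2)) M]

/-- The height function on `M`. -/
noncomputable def height (Φ : M ≃ₘ⟮𝓡 2, 𝓡 2⟯ S2) (q : M) : ℝ := (Φ q : EuclideanSpace ℝ (Fin 3)) 2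

lemma contMDiff_height (Φ : M ≃ₘ⟮𝓡 2, 𝓡 2⟯ S2) : ContMDiff (𝓡 2) 𝓘(ℝ, ℝ) ∞ (height Φ) := by
  have h : ContMDiff 𝓘(ℝ, EuclideanSpace ℝ (Fin 3)) 𝓘(ℝ, ℝ) ∞
      (fun v : EuclideanSpace ℝ (Fin 3) => v 2) := by
    rw [contMDiff_iff_contDiff]
    fun_prop
  exact h.comp (contMDiff_coe_S2.comp Φ.contMDiff)

lemma height_coordPoint (Φ : M ≃ₘ⟮𝓡 2, 𝓡 2⟯ S2) {x : ℝ} (hx : x ∈ Icc (-1 : ℝ) 1) (θ : ℝ) :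
    height Φ (coordPoint Φ x θ) = x := by
  simp only [height, coordPoint, Diffeomorph.apply_symm_apply]
  exact cylinderPoint_two hx θ

lemma exists_eq_coordPoint (Φ : M ≃ₘ⟮𝓡 2, 𝓡 2⟯ S2) (q : M) :
    ∃ x ∈ Icc (-1 : ℝ) 1, ∃ θ, q = coordPoint Φ x θ := by
  obtain ⟨x, hx, θ, h⟩ := exists_eq_cylinderPoint (Φ q)
  exact ⟨x, hx, θ, by rw [coordPoint, ← h, Diffeomorph.symm_apply_apply]⟩

variable [IsManifold (𝓡 2) ∞ M] [MulAction Circle M]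
  {g : SurfaceMetric M} {f : ℝ → ℝ} {Φ : M ≃ₘ⟮𝓡 2, 𝓡 2⟯ S2}

namespace IsMomentumForm

variable (hg : IsMomentumForm g f Φ)

include hg

lemma areaDensity_eq {x : ℝ} (hx : x ∈ Ioo (-1 : ℝ) 1) (θ : ℝ) :
    areaDensity g (coordPoint Φ) x θ = 1 := by
  have := (hg.f_pos x hx).ne'
  rw [areaDensity, hg.metric_xx x hx, hg.metric_xtheta x hx, hg.metric_thetatheta x hx]
  field_simp
  simp

/-- The Laplacian of a function of the height. -/
lemma laplaceBeltrami_eq {u : M → ℝ} {U : ℝ → ℝ}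
    (hu : ∀ x ∈ Ioo (-1 : ℝ) 1, ∀ θ, u (coordPoint Φ x θ) = U x) {x : ℝ}
    (hx : x ∈ Ioo (-1 : ℝ) 1) (θ : ℝ) :
    laplaceBeltrami g (coordPoint Φ) u x θ = deriv (fun s => f s * deriv U s) x := by
  have h1 : (fun s : ℝ => (gramG g (coordPoint Φ) s θ * deriv (fun r : ℝ => u (coordPoint Φ r θ)) s
          - gramF g (coordPoint Φ) s θ * deriv (fun r : ℝ => u (coordPoint Φ s r)) θ) /
          areaDensity g (coordPoint Φ) s θ) =ᶠ[𝓝 x] fun s => f s * deriv U s := by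
    filter_upwards [Ioo_mem_nhds hx.1 hx.2] with s hs
    have h2 : (fun r : ℝ => u (coordPoint Φ r θ)) =ᶠ[𝓝 s] U := by
      filter_upwards [Ioo_mem_nhds hs.1 hs.2] with r hr using hu r hr θ
    rw [hg.metric_thetatheta s hs, hg.metric_xtheta s hs, hg.areaDensity_eq hs, h2.deriv_eq]
    simp
  have h3 : (fun t : ℝ => (gramE g (coordPoint Φ) x t * deriv (fun r : ℝ => u (coordPoint Φ x r)) t
          - gramF g (coordPoint Φ) x t * deriv (fun r : ℝ => u (coordPoint Φ r t)) x) /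
          areaDensity g (coordPoint Φ) x t) = fun _ => 0 := by
    funext t
    rw [hg.metric_xtheta x hx, hg.areaDensity_eq hx]
    simp [hu x hx]
  rw [laplaceBeltrami, hg.areaDensity_eq hx, h1.deriv_eq, h3]
  simp

lemma invariant_eq {u : M → ℝ} (hu : ∀ (c : Circle) (q : M), u (c • q) = u q) {x : ℝ}
    (hx : x ∈ Icc (-1 : ℝ) 1) (θ : ℝ) : u (coordPoint Φ x θ) = u (coordPoint Φ x 0) := by
  rw [← hu (Circle.exp θ) (coordPoint Φ x 0), hg.smul_coord θ x 0 hx, zero_add]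

/-- A solution of the ordinary differential equation which is smooth on `[-1, 1]` gives an
invariant eigenfunction. -/
theorem isInvariantEigenvalue {l : ℝ} {U : ℝ → ℝ} (hU : ContDiffOn ℝ ∞ U (Icc (-1) 1))
    (hne : ∃ x ∈ Ioo (-1 : ℝ) 1, U x ≠ 0)
    (hode : ∀ x ∈ Ioo (-1 : ℝ) 1, deriv (fun s => f s * deriv U s) x = -(l * U x)) :
    IsInvariantEigenvalue g Φ l := by
  have hval : ∀ x ∈ Icc (-1 : ℝ) 1, ∀ θ, U (height Φ (coordPoint Φ x θ)) = U x :=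
    fun x hx θ => by rw [height_coordPoint Φ hx]
  refine ⟨fun q => U (height Φ q), ?_, fun h => ?_, fun c q => ?_, fun x hx θ => ?_⟩
  · rw [← contMDiffOn_univ]
    refine (contMDiffOn_iff_contDiffOn.2 hU).comp (contMDiff_height Φ).contMDiffOn fun q _ => ?_
    obtain ⟨x, hx, θ, rfl⟩ := exists_eq_coordPoint Φ q
    rw [mem_preimage, height_coordPoint Φ hx]
    exact hx
  · obtain ⟨x, hx, h1⟩ := hne
    exact h1 (by simpa [hval x (Ioo_subset_Icc_self hx) 0] using congrFun h (coordPoint Φ x 0))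
  · obtain ⟨x, hx, θ, rfl⟩ := exists_eq_coordPoint Φ q
    obtain ⟨t, rfl⟩ := Circle.exp_surjective c
    simp only [hg.smul_coord t x θ hx, hval x hx]
  · simp only
    rw [hg.laplaceBeltrami_eq (fun x hx θ => hval x (Ioo_subset_Icc_self hx) θ) hx,
      hode x hx, hval x (Ioo_subset_Icc_self hx), neg_neg]

/-- An invariant eigenfunction gives a Dirichlet solution. -/
theorem exists_dirichlet_solution {p : ℝ → ℝ} (hp : Continuous p) (hpos : ∀ x, 0 < p x)
    (hps : ContDiffOn ℝ ∞ p (Icc (-1) 1)) (hfp : ∀ x ∈ Icc (-1 : ℝ) 1, f x = (1 - x ^ 2) * p x)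
    {m : ℝ} (hm : m ≠ 0) (h : IsInvariantEigenvalue g Φ m) :
    ∃ (φ dφ : ℝ → ℝ) (C : ℝ), IsSturmLiouvilleSolution p m φ dφ ∧
      (∀ x ∈ Ioo (-1 : ℝ) 1, |φ x| ≤ C * (1 - x ^ 2)) ∧ (∀ x ∈ Ioo (-1 : ℝ) 1, |dφ x| ≤ C) ∧
      ∃ x ∈ Ioo (-1 : ℝ) 1, φ x ≠ 0 := by
  obtain ⟨u, hu, hu0, hinv, heq⟩ := h
  -- `S` is `u` along a meridian, as a function of the colatitude; it is smooth through the poles,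
  -- unlike `U` in general.
  set S : ℝ → ℝ := fun s => u (Φ.symm (polarPoint s 0)) with hSdef
  have hS : ContDiff ℝ ∞ S := by
    rw [← contMDiff_iff_contDiff]
    have h1 : ContMDiff 𝓘(ℝ, ℝ) 𝓘(ℝ, ℝ × ℝ) ∞ fun s : ℝ => (s, (0 : ℝ)) := by
      rw [contMDiff_iff_contDiff]; fun_prop
    have h2 := contMDiff_polarPoint.comp h1
    exact hu.comp (Φ.symm.contMDiff.comp h2)
  have hS' : ContDiff ℝ ∞ (deriv S) := (contDiff_infty_iff_deriv.1 hS).2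
  have hSc := hS.continuous
  have hSc' := hS'.continuous
  set U : ℝ → ℝ := fun x => S (arccos x) with hUdef
  have hUc : Continuous U := hSc.comp continuous_arccos
  have huU : ∀ x ∈ Icc (-1 : ℝ) 1, ∀ θ, u (coordPoint Φ x θ) = U x := fun x hx θ => by
    rw [hg.invariant_eq hinv hx, coordPoint, cylinderPoint_eq_polarPoint hx]
  have hsq : ∀ x ∈ Ioo (-1 : ℝ) 1, 0 < √(1 - x ^ 2) := fun x hx => sqrt_pos.2 (one_sub_sq_pos hx)
  have hU' : ∀ x ∈ Ioo (-1 : ℝ) 1,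
      HasDerivAt U (deriv S (arccos x) * -(1 / √(1 - x ^ 2))) x := fun x hx =>
    ((hS.differentiable (by simp)) _).hasDerivAt.comp x
      (hasDerivAt_arccos hx.1.ne' hx.2.ne)
  -- This is `f U'` with the factor `1 / √(1 - x²)` of `arccos'` cancelled, so that it is visibly
  -- continuous and zero at `±1`.
  set φ : ℝ → ℝ := fun x => -(√(1 - x ^ 2) * p x * deriv S (arccos x)) with hφdef
  have hφc : Continuous φ := by
    have := hSc'.comp continuous_arccos
    simp only [Function.comp_def] at this
    fun_prop
  have hφU : ∀ x ∈ Ioo (-1 : ℝ) 1, f x * deriv U x = φ x := fun x hx => by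
    have h1 := (hsq x hx).ne'
    have h2 := Real.sq_sqrt (one_sub_sq_pos hx).le
    rw [hfp x (Ioo_subset_Icc_self hx), (hU' x hx).deriv, hφdef]
    field_simp
    linear_combination (p x * deriv S (arccos x)) * h2
  have hUφ : ∀ x ∈ Ioo (-1 : ℝ) 1, HasDerivAt U (φ x / ((1 - x ^ 2) * p x)) x := fun x hx => by
    refine (hU' x hx).congr_deriv ?_
    rw [← hφU x hx, hfp x (Ioo_subset_Icc_self hx), (hU' x hx).deriv,
      mul_div_cancel_left₀ _ (mul_pos (one_sub_sq_pos hx) (hpos x)).ne']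
  have hφd : ∀ x ∈ Ioo (-1 : ℝ) 1, HasDerivAt φ (-(m * U x)) x := fun x hx => by
    have h1 : DifferentiableAt ℝ φ x := by
      have h2 : DifferentiableAt ℝ p x :=
        (hps.contDiffAt (Icc_mem_nhds hx.1 hx.2)).differentiableAt (by simp)
      have h3 : DifferentiableAt ℝ (fun x => deriv S (arccos x)) x :=
        ((hS'.differentiable (by simp)) _).comp x
          (hasDerivAt_arccos hx.1.ne' hx.2.ne).differentiableAt
      have h4 : DifferentiableAt ℝ (fun x : ℝ => √(1 - x ^ 2)) x :=
        DifferentiableAt.sqrt (by fun_prop) (one_sub_sq_pos hx).ne'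
      exact ((h4.mul h2).mul h3).neg
    have h5 : (fun s => f s * deriv U s) =ᶠ[𝓝 x] φ := by
      filter_upwards [Ioo_mem_nhds hx.1 hx.2] with y hy using hφU y hy
    have h6 := heq x hx 0
    rw [hg.laplaceBeltrami_eq (fun x hx θ => huU x (Ioo_subset_Icc_self hx) θ) hx, h5.deriv_eq,
      huU x (Ioo_subset_Icc_self hx)] at h6
    exact h1.hasDerivAt.congr_deriv (by linarith)
  obtain ⟨C, hC⟩ := (isCompact_Icc (a := (-1 : ℝ)) (b := 1)).exists_bound_of_continuousOn
    (f := fun x => -(m * U x)) (by fun_prop)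
  have hC0 : 0 ≤ C := (norm_nonneg _).trans (hC 0 (by norm_num))
  refine ⟨φ, fun x => -(m * U x), C, fun x hx => ⟨hφd x hx, ?_⟩, fun x hx => ?_,
    fun x hx => hC x (Ioo_subset_Icc_self hx), ?_⟩
  · exact ((hUφ x hx).const_mul m).neg.congr_deriv (by ring)
  -- The mean value theorem towards the nearer end point gives `|φ| ≤ C (1 - |x|)`, and `1 - |x| ≤ 1
  -- - x²`.
  · rcases le_total 0 x with h0 | h0
    · obtain ⟨c, hc, hc'⟩ := exists_hasDerivAt_eq_slope φ (fun x => -(m * U x)) hx.2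
        hφc.continuousOn fun y hy => hφd y ⟨hx.1.trans hy.1, hy.2⟩
      have h1 := hC c ⟨(hx.1.trans hc.1).le, hc.2.le⟩
      have h2 : 0 < 1 - x := by linarith [hx.2]
      rw [hc', show φ 1 = 0 by simp [hφdef], zero_sub, norm_div, norm_neg, Real.norm_eq_abs,
        Real.norm_eq_abs, abs_of_pos h2, div_le_iff₀ h2] at h1
      nlinarith [mul_nonneg hC0 (mul_nonneg h2.le h0)]
    · obtain ⟨c, hc, hc'⟩ := exists_hasDerivAt_eq_slope φ (fun x => -(m * U x)) hx.1
        hφc.continuousOn fun y hy => hφd y ⟨hy.1, hy.2.trans hx.2⟩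
      have h1 := hC c ⟨hc.1.le, (hc.2.trans hx.2).le⟩
      have h2 : 0 < x - -1 := by linarith [hx.1]
      rw [hc', show φ (-1) = 0 by simp [hφdef], sub_zero, norm_div, Real.norm_eq_abs,
        Real.norm_eq_abs, abs_of_pos h2, div_le_iff₀ h2] at h1
      nlinarith [mul_nonneg hC0 (mul_nonneg h2.le (neg_nonneg.2 h0))]
  -- If `φ` vanished, so would `φ' = -m U`; here `m ≠ 0` excludes the constant eigenfunctions.
  · by_contra! hall
    have h1 : EqOn U (fun _ => 0) (Ioo (-1) 1) := fun x hx => by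
      have h2 : φ =ᶠ[𝓝 x] fun _ => 0 := by
        filter_upwards [Ioo_mem_nhds hx.1 hx.2] with y hy using hall y hy
      have h3 := (hφd x hx).unique ((hasDerivAt_const x (0 : ℝ)).congr_of_eventuallyEq h2)
      simpa [hm] using h3
    have h4 := EqOn.of_subset_closure h1 hUc.continuousOn continuousOn_const Ioo_subset_Icc_self
      Icc_subset_closure_Ioo
    refine hu0 (funext fun q => ?_)
    obtain ⟨x, hx, θ, rfl⟩ := exists_eq_coordPoint Φ q
    rw [huU x hx, h4 hx, Pi.zero_apply]

end IsMomentumForm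

end

/-! ### Differentials of maps to the sphere and velocities of curves -/

section

variable {M : Type*} [TopologicalSpace M] [ChartedSpace (EuclideanSpace ℝ (Fin 2)) M]

/-- The differential of `F : M → S²`, followed by the inclusion of `S²`. -/
noncomputable def ambientDeriv (F : M → S2) (q : M) :
    TangentSpace (𝓡 2) q →L[ℝ] EuclideanSpace ℝ (Fin 3) :=
  (mfderiv (𝓡 2) 𝓘(ℝ, EuclideanSpace ℝ (Fin 3)) (fun q : S2 => (q : EuclideanSpace ℝ (Fin 3))) (F q) :
    TangentSpace (𝓡 2) (F q) →L[ℝ] EuclideanSpace ℝ (Fin 3)).comp (mfderiv (𝓡 2) (𝓡 2) F q)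

lemma roundInner_mfderiv (F : M → S2) (q : M) (v w : TangentSpace (𝓡 2) q) :
    roundInner (F q) (mfderiv (𝓡 2) (𝓡 2) F q v) (mfderiv (𝓡 2) (𝓡 2) F q w) =
      inner ℝ (ambientDeriv F q v) (ambientDeriv F q w) := rfl

lemma ambientDeriv_velocity {F : M → S2} (hF : ContMDiff (𝓡 2) (𝓡 2) ∞ F) {γ : ℝ → M} {t : ℝ}
    (hγ : MDifferentiableAt 𝓘(ℝ, ℝ) (𝓡 2) γ t) :
    ambientDeriv F (γ t) (mfderiv 𝓘(ℝ, ℝ) (𝓡 2) γ t (1 : ℝ)) =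
      deriv (fun s => (F (γ s) : EuclideanSpace ℝ (Fin 3))) t := by
  have h1 : MDifferentiableAt (𝓡 2) 𝓘(ℝ, EuclideanSpace ℝ (Fin 3))
      (fun q : S2 => (q : EuclideanSpace ℝ (Fin 3))) (F (γ t)) :=
    (contMDiff_coe_S2 _).mdifferentiableAt (by simp)
  have h2 : MDifferentiableAt (𝓡 2) (𝓡 2) F (γ t) := (hF _).mdifferentiableAt (by simp)
  have h3 := mfderiv_comp t (h1.comp (γ t) h2) hγ
  rw [mfderiv_comp (γ t) h1 h2, mfderiv_eq_fderiv] at h3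
  have h4 := congrArg (fun A : ℝ →L[ℝ] EuclideanSpace ℝ (Fin 3) => A 1) h3
  exact h4.symm

variable [IsManifold (𝓡 2) ∞ M]

/-- The coordinates say nothing about `g` at a pole; this determines it there as a limit along a
curve. -/
lemma continuous_inner_velocity (g : SurfaceMetric M) {η : ℝ → M}
    (hη : ContMDiff 𝓘(ℝ, ℝ) (𝓡 2) ∞ η) :
    Continuous fun t => g.inner (η t) (mfderiv 𝓘(ℝ, ℝ) (𝓡 2) η t (1 : ℝ))
      (mfderiv 𝓘(ℝ, ℝ) (𝓡 2) η t (1 : ℝ)) := by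
  have h1 : ContMDiff 𝓘(ℝ, ℝ) 𝓘(ℝ, ℝ).tangent 0
      (fun t : ℝ => (⟨t, (1 : ℝ)⟩ : TangentBundle 𝓘(ℝ, ℝ) ℝ)) := fun t =>
    contMDiffAt_vectorSpace_iff_contDiffAt.2 contDiffAt_const
  have h2 : ContMDiff 𝓘(ℝ, ℝ) (𝓡 2).tangent 0 (fun t : ℝ =>
      Bundle.TotalSpace.mk' (EuclideanSpace ℝ (Fin 2)) (E := fun q : M => TangentSpace (𝓡 2) q) (η t)
        (mfderiv 𝓘(ℝ, ℝ) (𝓡 2) η t (1 : ℝ))) :=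
    (hη.contMDiff_tangentMap (m := 0) (by simp)).comp h1
  have h3 : ContMDiff 𝓘(ℝ, ℝ) ((𝓡 2).prod 𝓘(ℝ)) 0
      (fun t ↦ Bundle.TotalSpace.mk' ℝ (E := Bundle.Trivial M ℝ) (η t)
        (g.inner (η t) (mfderiv 𝓘(ℝ, ℝ) (𝓡 2) η t (1 : ℝ))
      (mfderiv 𝓘(ℝ, ℝ) (𝓡 2) η t (1 : ℝ)))) := by
    apply ContMDiff.clm_bundle_apply₂ (F₁ := EuclideanSpace ℝ (Fin 2))
      (F₂ := EuclideanSpace ℝ (Fin 2))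
    · exact (g.contMDiff.of_le (by simp)).comp (hη.of_le (by simp))
    · exact h2
    · exact h2
  refine continuous_iff_continuousAt.2 fun t => ?_
  have h4 := h3 t
  simp only [Bundle.contMDiffAt_totalSpace] at h4
  exact h4.2.continuousAt

end

/-! ### Curvature one forces the second derivative of the profile -/

/-- The domain of the cylinder coordinates. -/
def cylinderDomain : Set (ℝ × ℝ) := Ioo (-1) 1 ×ˢ univ

lemma isOpen_cylinderDomain : IsOpen cylinderDomain := isOpen_Ioo.prod isOpen_univ

/-- The directional derivative `∂_v a`. -/
noncomputable def dirDeriv {E : Type*} [NormedAddCommGroup E] [NormedSpace ℝ E] (v : ℝ × ℝ)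
    (a : ℝ × ℝ → E) (q : ℝ × ℝ) : E := fderiv ℝ a q v

section

variable {E : Type*} [NormedAddCommGroup E] [InnerProductSpace ℝ E] {a b : ℝ × ℝ → E}

lemma contDiffOn_dirDeriv (ha : ContDiffOn ℝ ∞ a cylinderDomain) (v : ℝ × ℝ) :
    ContDiffOn ℝ ∞ (dirDeriv v a) cylinderDomain :=
  (ha.fderiv_of_isOpen isOpen_cylinderDomain (by simp)).clm_apply contDiffOn_const

lemma dirDeriv_comm (ha : ContDiffOn ℝ ∞ a cylinderDomain) {q : ℝ × ℝ} (hq : q ∈ cylinderDomain)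
    (v w : ℝ × ℝ) : dirDeriv v (dirDeriv w a) q = dirDeriv w (dirDeriv v a) q := by
  have h1 : ContDiffAt ℝ ∞ a q := ha.contDiffAt (isOpen_cylinderDomain.mem_nhds hq)
  have h2 : DifferentiableAt ℝ (fderiv ℝ a) q :=
    (h1.fderiv_right (m := 1) (by norm_cast)).differentiableAt (by simp)
  have h3 : ∀ w v, dirDeriv v (dirDeriv w a) q = fderiv ℝ (fderiv ℝ a) q v w := fun w v => by
    unfold dirDeriv
    rw [fderiv_clm_apply h2 (differentiableAt_const _)]
    simp
  rw [h3, h3]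
  exact ((contDiffAt_infty.1 h1 2).isSymmSndFDerivAt (by simp)).eq v w

/-- The product rule applied to an identity `⟪a, b⟫ = h(x)`. -/
lemma inner_dirDeriv_add (ha : ContDiffOn ℝ ∞ a cylinderDomain)
    (hb : ContDiffOn ℝ ∞ b cylinderDomain) {h : ℝ → ℝ} {d : ℝ}
    (hab : ∀ q ∈ cylinderDomain, inner ℝ (a q) (b q) = h q.1) {q : ℝ × ℝ}
    (hq : q ∈ cylinderDomain) (hd : HasDerivAt h d q.1) (v : ℝ × ℝ) :
    inner ℝ (a q) (dirDeriv v b q) + inner ℝ (dirDeriv v a q) (b q) = v.1 * d := by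
  have hn := isOpen_cylinderDomain.mem_nhds hq
  have h1 := (ha.contDiffAt hn).differentiableAt (by simp)
  have h2 := (hb.contDiffAt hn).differentiableAt (by simp)
  have h3 : (fun q => inner ℝ (a q) (b q)) =ᶠ[𝓝 q] fun q => h q.1 := by
    filter_upwards [hn] with y hy using hab y hy
  have h4 : HasFDerivAt (fun q : ℝ × ℝ => h q.1) (d • ContinuousLinearMap.fst ℝ ℝ ℝ) q :=
    hd.comp_hasFDerivAt q hasFDerivAt_fst
  have h5 := fderiv_inner_apply ℝ h1 h2 v
  rw [h3.fderiv_eq, h4.fderiv] at h5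
  simpa [mul_comm, dirDeriv] using h5.symm

end

/-- Parseval's identity for an orthogonal frame of `ℝ³`. -/
lemma inner_eq_of_orthogonal_frame {u v w : EuclideanSpace ℝ (Fin 3)} {f : ℝ} (hf : 0 < f)
    (huu : inner ℝ u u = (1 : ℝ)) (hvv : inner ℝ v v = 1 / f) (hww : inner ℝ w w = f)
    (huv : inner ℝ u v = (0 : ℝ)) (huw : inner ℝ u w = (0 : ℝ)) (hvw : inner ℝ v w = (0 : ℝ))
    (a b : EuclideanSpace ℝ (Fin 3)) :
    inner ℝ a b = inner ℝ u a * inner ℝ u b + f * (inner ℝ v a * inner ℝ v b) +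
      inner ℝ w a * inner ℝ w b / f := by
  have hs := (sqrt_pos.2 hf).ne'
  have hs2 := Real.mul_self_sqrt hf.le
  have ho : Orthonormal ℝ ![u, √f • v, (√f)⁻¹ • w] := by
    rw [orthonormal_iff_ite]
    intro i j
    fin_cases i <;> fin_cases j <;>
      simp [real_inner_smul_left, real_inner_smul_right, huu, hvv, hww, huv, huw, hvw,
        real_inner_comm u v, real_inner_comm u w, real_inner_comm v w, -inner_self_eq_norm_sq_to_K]
    · rw [← mul_assoc, hs2, mul_inv_cancel₀ hf.ne']
    · rw [← mul_assoc, ← mul_inv, hs2, inv_mul_cancel₀ hf.ne']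
  have hspan : ⊤ ≤ Submodule.span ℝ (Set.range ![u, √f • v, (√f)⁻¹ • w]) :=
    (ho.linearIndependent.span_eq_top_of_card_eq_finrank (by simp)).ge
  have h := (OrthonormalBasis.mk ho hspan).sum_inner_mul_inner a b
  simp only [OrthonormalBasis.coe_mk, Fin.sum_univ_three, Matrix.cons_val_zero, Matrix.cons_val_one,
    Matrix.cons_val, real_inner_smul_left, real_inner_smul_right] at h
  rw [← h, real_inner_comm u a, real_inner_comm v a, real_inner_comm w a]
  have hs3 : (√f)⁻¹ * (√f)⁻¹ = f⁻¹ := by rw [← mul_inv, hs2]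
  rw [div_eq_mul_inv, ← hs3]
  linear_combination (inner ℝ v a * inner ℝ v b) * hs2

/-- The Gauss equation for a metric `dx² / f + f dθ²` of curvature one. -/
theorem deriv_deriv_eq_of_isometric {r : ℝ × ℝ → EuclideanSpace ℝ (Fin 3)} {f : ℝ → ℝ}
    (hr : ContDiffOn ℝ ∞ r cylinderDomain) (hf : ContDiffOn ℝ ∞ f (Ioo (-1) 1))
    (hpos : ∀ x ∈ Ioo (-1 : ℝ) 1, 0 < f x)
    (h0 : ∀ q ∈ cylinderDomain, inner ℝ (r q) (r q) = (1 : ℝ))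
    (hxx : ∀ q ∈ cylinderDomain, inner ℝ (dirDeriv (1, 0) r q) (dirDeriv (1, 0) r q) = 1 / f q.1)
    (hxt : ∀ q ∈ cylinderDomain, inner ℝ (dirDeriv (1, 0) r q) (dirDeriv (0, 1) r q) = (0 : ℝ))
    (htt : ∀ q ∈ cylinderDomain, inner ℝ (dirDeriv (0, 1) r q) (dirDeriv (0, 1) r q) = f q.1)
    {x : ℝ} (hx : x ∈ Ioo (-1 : ℝ) 1) : HasDerivAt (deriv f) (-2) x := by
  set X := dirDeriv (1, 0) r
  set T := dirDeriv (0, 1) r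
  have hX : ContDiffOn ℝ ∞ X cylinderDomain := contDiffOn_dirDeriv hr _
  have hT : ContDiffOn ℝ ∞ T cylinderDomain := contDiffOn_dirDeriv hr _
  set XX := dirDeriv (1, 0) X
  set XT := dirDeriv (1, 0) T
  set TT := dirDeriv (0, 1) T
  have hXT : ContDiffOn ℝ ∞ XT cylinderDomain := contDiffOn_dirDeriv hT _
  have hTT : ContDiffOn ℝ ∞ TT cylinderDomain := contDiffOn_dirDeriv hT _
  have hTX : ∀ q ∈ cylinderDomain, dirDeriv (0, 1) X q = XT q := fun q hq => dirDeriv_comm hr hq _ _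
  have hfd : ∀ q ∈ cylinderDomain, HasDerivAt f (deriv f q.1) q.1 := fun q hq =>
    ((hf.contDiffAt (isOpen_Ioo.mem_nhds hq.1)).differentiableAt (by simp)).hasDerivAt
  have hconst : ∀ {c : ℝ} (q : ℝ × ℝ), HasDerivAt (fun _ : ℝ => c) 0 q.1 := fun q =>
    hasDerivAt_const _ _
  have e1 : ∀ q ∈ cylinderDomain, inner ℝ (r q) (X q) = (0 : ℝ) := fun q hq => by
    have := inner_dirDeriv_add hr hr (h := fun _ => 1) h0 hq (hconst q) (1, 0)
    rw [real_inner_comm (r q)] at this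
    linarith
  have e2 : ∀ q ∈ cylinderDomain, inner ℝ (r q) (T q) = (0 : ℝ) := fun q hq => by
    have := inner_dirDeriv_add hr hr (h := fun _ => 1) h0 hq (hconst q) (0, 1)
    rw [real_inner_comm (r q)] at this
    linarith
  have e3 : ∀ q ∈ cylinderDomain, inner ℝ (X q) (XT q) = (0 : ℝ) := fun q hq => by
    have := inner_dirDeriv_add hX hX (h := fun x => 1 / f x) hxx hq
      (((hasDerivAt_const _ 1).div (hfd q hq) (hpos _ hq.1).ne')) (0, 1)
    rw [hTX q hq, real_inner_comm (X q)] at this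
    linarith
  have e4 : ∀ q ∈ cylinderDomain, inner ℝ (T q) (XT q) = deriv f q.1 / 2 := fun q hq => by
    have := inner_dirDeriv_add hT hT htt hq (hfd q hq) (1, 0)
    rw [real_inner_comm (T q)] at this
    linarith
  have e5 : ∀ q ∈ cylinderDomain, inner ℝ (X q) (TT q) = -(deriv f q.1 / 2) := fun q hq => by
    have := inner_dirDeriv_add hX hT (h := fun _ => 0) hxt hq (hconst q) (0, 1)
    rw [hTX q hq, real_inner_comm (T q), e4 q hq] at this
    linarith
  set q : ℝ × ℝ := (x, 0)
  have hq : q ∈ cylinderDomain := ⟨hx, mem_univ _⟩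
  have hfx := hpos x hx
  have e6 : inner ℝ (r q) (XX q) = -(1 / f x) := by
    have := inner_dirDeriv_add hr hX (h := fun _ => 0) e1 hq (hconst q) (1, 0)
    rw [hxx q hq] at this
    linarith
  have e7 : inner ℝ (r q) (XT q) = (0 : ℝ) := by
    have := inner_dirDeriv_add hr hT (h := fun _ => 0) e2 hq (hconst q) (1, 0)
    rw [hxt q hq] at this
    linarith
  have e8 : inner ℝ (r q) (TT q) = -f x := by
    have := inner_dirDeriv_add hr hT (h := fun _ => 0) e2 hq (hconst q) (0, 1)
    rw [htt q hq] at this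
    linarith
  have e9 : inner ℝ (X q) (XX q) = -(deriv f x / (2 * f x ^ 2)) := by
    have := inner_dirDeriv_add hX hX (h := fun x => 1 / f x) hxx hq
      (((hasDerivAt_const _ 1).div (hfd q hq) hfx.ne')) (1, 0)
    rw [real_inner_comm (X q)] at this
    have h2 : inner ℝ (X q) (XX q) = (0 * f x - 1 * deriv f x) / f x ^ 2 / 2 := by linarith
    rw [h2]
    field_simp
    ring
  have e10 : inner ℝ (T q) (TT q) = (0 : ℝ) := by
    have := inner_dirDeriv_add hT hT htt hq (hfd q hq) (0, 1)
    rw [real_inner_comm (T q)] at this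
    linarith
  -- `r`, `X`, `T` form an orthogonal frame of the ambient space, so products of second derivatives
  -- reduce to the frame components already computed.
  have hpars := inner_eq_of_orthogonal_frame hfx (h0 q hq) (hxx q hq) (htt q hq) (e1 q hq) (e2 q hq)
    (hxt q hq)
  have p1 : inner ℝ (XX q) (TT q) = 1 + deriv f x ^ 2 / (4 * f x) := by
    rw [hpars, e6, e8, e9, e5 q hq, e10]
    field_simp
    ring
  have p2 : inner ℝ (XT q) (XT q) = deriv f x ^ 2 / (4 * f x) := by
    rw [hpars, e7, e3 q hq, e4 q hq]
    field_simp
    ring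
  have hf' : HasDerivAt (deriv f) (deriv (deriv f) x) x := by
    have := (hf.deriv_of_isOpen (m := ∞) isOpen_Ioo (by simp)).contDiffAt (isOpen_Ioo.mem_nhds hx)
    exact (this.differentiableAt (by simp)).hasDerivAt
  -- Differentiate `⟪X, TT⟫` in `x` and `⟪X, XT⟫` in `θ`. The third derivatives agree, and
  -- subtracting leaves `-f''/2 = ⟪XX, TT⟫ - ⟪XT, XT⟫ = 1`.
  have d1 := inner_dirDeriv_add hX hTT (h := fun x => -(deriv f x / 2)) e5 hq
    ((hf'.div_const 2).neg) (1, 0)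
  have d2 := inner_dirDeriv_add hX hXT (h := fun _ => 0) e3 hq (hconst q) (0, 1)
  have d3 : dirDeriv (1, 0) TT q = dirDeriv (0, 1) XT q := dirDeriv_comm hT hq _ _
  rw [hTX q hq, p2] at d2
  rw [d3, p1] at d1
  refine hf'.congr_deriv ?_
  linarith

theorem eq_one_sub_sq_of_deriv_deriv {f : ℝ → ℝ} (hf : ContinuousOn f (Icc (-1) 1))
    (hd : ∀ x ∈ Ioo (-1 : ℝ) 1, DifferentiableAt ℝ f x)
    (hdd : ∀ x ∈ Ioo (-1 : ℝ) 1, HasDerivAt (deriv f) (-2) x) (hl : f (-1) = 0) (hr : f 1 = 0) :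
    ∀ x ∈ Icc (-1 : ℝ) 1, f x = 1 - x ^ 2 := by
  obtain ⟨c, hc⟩ := eqOn_add_const hdd (G := fun x => -2 * x) fun x _ => by
    simpa using (hasDerivAt_id x).const_mul (-2)
  obtain ⟨d, hd'⟩ := eqOn_add_const (g := f) (d := deriv f) (fun x hx => (hd x hx).hasDerivAt)
    (G := fun x => c * x - x ^ 2) fun x hx => by
      rw [hc x hx]
      refine (((hasDerivAt_id x).const_mul c).sub (hasDerivAt_pow 2 x)).congr_deriv ?_
      simp
      ring
  have h := EqOn.of_subset_closure (g := fun x => c * x - x ^ 2 + d) hd' hf (by fun_prop)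
    Ioo_subset_Icc_self Icc_subset_closure_Ioo
  have h1 := h (show (-1 : ℝ) ∈ Icc (-1 : ℝ) 1 by simp)
  have h2 := h (show (1 : ℝ) ∈ Icc (-1 : ℝ) 1 by simp)
  simp only [hl, hr] at h1 h2
  intro x hx
  rw [h hx]
  have h3 : c = 0 := by linarith
  have h4 : d = 1 := by linarith
  rw [h3, h4]
  ring

lemma inner_velocity_eq {a a' b b' : ℝ → ℝ} {c c' : ℝ → ℝ} {x y : ℝ} {a₁ a₂ b₁ b₂ c₁ c₂ : ℝ}
    (ha : HasDerivAt a a₁ x) (hb : HasDerivAt b b₁ x) (hc : HasDerivAt c c₁ x)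
    (ha' : HasDerivAt a' a₂ y) (hb' : HasDerivAt b' b₂ y) (hc' : HasDerivAt c' c₂ y) :
    inner ℝ (deriv (fun s => !₂[a s, b s, c s]) x) (deriv (fun s => !₂[a' s, b' s, c' s]) y) =
      a₁ * a₂ + b₁ * b₂ + c₁ * c₂ := by
  have h : ∀ {a b c : ℝ → ℝ} {x a₁ b₁ c₁ : ℝ}, HasDerivAt a a₁ x → HasDerivAt b b₁ x →
      HasDerivAt c c₁ x → HasDerivAt (fun s => !₂[a s, b s, c s]) !₂[a₁, b₁, c₁] x := by
    intro a b c x a₁ b₁ c₁ ha hb hc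
    rw [hasDerivAt_iff_hasFDerivAt, ← hasFDerivWithinAt_univ, hasFDerivWithinAt_euclidean]
    intro i
    rw [hasFDerivWithinAt_univ]
    fin_cases i
    · exact ha.hasFDerivAt.congr_fderiv (by ext; simp)
    · exact hb.hasFDerivAt.congr_fderiv (by ext; simp)
    · exact hc.hasFDerivAt.congr_fderiv (by ext; simp)
  rw [(h ha hb hc).deriv, (h ha' hb' hc').deriv]
  simp [PiLp.inner_apply, Fin.sum_univ_three]
  ring

/-! ### Isometries with the round sphere, off the poles -/

section

variable {M : Type*} [TopologicalSpace M] [ChartedSpace (EuclideanSpace ℝ (Fin 2)) M]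
  {Φ : M ≃ₘ⟮𝓡 2, 𝓡 2⟯ S2}

lemma contMDiff_symm_polarPoint (Φ : M ≃ₘ⟮𝓡 2, 𝓡 2⟯ S2) :
    ContMDiff 𝓘(ℝ, ℝ × ℝ) (𝓡 2) ∞ (fun q : ℝ × ℝ => Φ.symm (polarPoint q.1 q.2)) :=
  Φ.symm.contMDiff.comp contMDiff_polarPoint

lemma mdifferentiableAt_coordPoint_left {x : ℝ} (hx : x ∈ Ioo (-1 : ℝ) 1) (θ : ℝ) :
    MDifferentiableAt 𝓘(ℝ, ℝ) (𝓡 2) (fun s => coordPoint Φ s θ) x := by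
  have h1 : MDifferentiableAt 𝓘(ℝ, ℝ) 𝓘(ℝ, ℝ × ℝ) (fun s => (arccos s, θ)) x := by
    rw [mdifferentiableAt_iff_differentiableAt]
    exact (hasDerivAt_arccos hx.1.ne' hx.2.ne).differentiableAt.prodMk (differentiableAt_const _)
  have h2 := ((contMDiff_symm_polarPoint Φ (arccos x, θ)).mdifferentiableAt (by simp)).comp x h1
  refine h2.congr_of_eventuallyEq ?_
  filter_upwards [Ioo_mem_nhds hx.1 hx.2] with s hs
  rw [coordPoint, cylinderPoint_eq_polarPoint (Ioo_subset_Icc_self hs)]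
  rfl

lemma mdifferentiableAt_coordPoint_right {x : ℝ} (hx : x ∈ Ioo (-1 : ℝ) 1) (θ : ℝ) :
    MDifferentiableAt 𝓘(ℝ, ℝ) (𝓡 2) (fun t => coordPoint Φ x t) θ := by
  have h1 : MDifferentiableAt 𝓘(ℝ, ℝ) 𝓘(ℝ, ℝ × ℝ) (fun t => (arccos x, t)) θ := by
    rw [mdifferentiableAt_iff_differentiableAt]
    fun_prop
  have h2 := ((contMDiff_symm_polarPoint Φ (arccos x, θ)).mdifferentiableAt (by simp)).comp θ h1
  refine h2.congr_of_eventuallyEq (Eventually.of_forall fun s => ?_)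
  simp only [coordPoint, cylinderPoint_eq_polarPoint (Ioo_subset_Icc_self hx)]
  rfl

lemma ambientDeriv_coordVecX {F : M → S2} (hF : ContMDiff (𝓡 2) (𝓡 2) ∞ F) {x : ℝ}
    (hx : x ∈ Ioo (-1 : ℝ) 1) (θ : ℝ) :
    ambientDeriv F (coordPoint Φ x θ) (coordVecX (coordPoint Φ) x θ) =
      deriv (fun s => (F (coordPoint Φ s θ) : EuclideanSpace ℝ (Fin 3))) x :=
  ambientDeriv_velocity hF (mdifferentiableAt_coordPoint_left hx θ)

lemma ambientDeriv_coordVecTheta {F : M → S2} (hF : ContMDiff (𝓡 2) (𝓡 2) ∞ F) {x : ℝ}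
    (hx : x ∈ Ioo (-1 : ℝ) 1) (θ : ℝ) :
    ambientDeriv F (coordPoint Φ x θ) (coordVecTheta (coordPoint Φ) x θ) =
      deriv (fun t => (F (coordPoint Φ x t) : EuclideanSpace ℝ (Fin 3))) θ :=
  ambientDeriv_velocity hF (mdifferentiableAt_coordPoint_right hx θ)

variable [IsManifold (𝓡 2) ∞ M] [MulAction Circle M] {g : SurfaceMetric M} {f : ℝ → ℝ}

namespace IsMomentumForm

variable (hg : IsMomentumForm g f Φ)

include hg

/-- A surface in momentum coordinates which is isometric to the round sphere has the profile
`1 - x²`. -/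
theorem profile_eq_of_isometric (hiso : IsIsometricToRoundSphere g) :
    ∀ x ∈ Icc (-1 : ℝ) 1, f x = 1 - x ^ 2 := by
  obtain ⟨F, hF⟩ := hiso
  have hFs : ContMDiff (𝓡 2) (𝓡 2) ∞ F := F.contMDiff
  set r : ℝ × ℝ → EuclideanSpace ℝ (Fin 3) := fun q => F (coordPoint Φ q.1 q.2) with hrdef
  have hr : ContDiffOn ℝ ∞ r cylinderDomain := by
    have h1 : ContDiff ℝ ∞ fun q : ℝ × ℝ =>
        (F (Φ.symm (polarPoint q.1 q.2)) : EuclideanSpace ℝ (Fin 3)) := by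
      rw [← contMDiff_iff_contDiff]
      exact contMDiff_coe_S2.comp (hFs.comp (contMDiff_symm_polarPoint Φ))
    have h2 : ContDiffOn ℝ ∞ (fun q : ℝ × ℝ => (arccos q.1, q.2)) cylinderDomain := fun q hq =>
      (((contDiffAt_arccos hq.1.1.ne' hq.1.2.ne).comp q contDiffAt_fst).prodMk
        contDiffAt_snd).contDiffWithinAt
    refine (h1.comp_contDiffOn h2).congr fun q hq => ?_
    simp only [hrdef, coordPoint, cylinderPoint_eq_polarPoint (Ioo_subset_Icc_self hq.1)]
    rfl
  have hrd : ∀ q ∈ cylinderDomain, HasFDerivAt r (fderiv ℝ r q) q := fun q hq =>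
    ((hr.contDiffAt (isOpen_cylinderDomain.mem_nhds hq)).differentiableAt (by simp)).hasFDerivAt
  have hX : ∀ q ∈ cylinderDomain, dirDeriv (1, 0) r q =
      ambientDeriv F (coordPoint Φ q.1 q.2) (coordVecX (coordPoint Φ) q.1 q.2) := fun q hq => by
    rw [ambientDeriv_coordVecX hFs hq.1]
    have h1 : HasDerivAt (fun s : ℝ => (s, q.2)) ((1, 0) : ℝ × ℝ) q.1 :=
      (hasDerivAt_id q.1).prodMk (hasDerivAt_const _ _)
    exact ((hrd q hq).comp_hasDerivAt q.1 h1).deriv.symm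
  have hT : ∀ q ∈ cylinderDomain, dirDeriv (0, 1) r q =
      ambientDeriv F (coordPoint Φ q.1 q.2) (coordVecTheta (coordPoint Φ) q.1 q.2) := fun q hq => by
    rw [ambientDeriv_coordVecTheta hFs hq.1]
    have h1 : HasDerivAt (fun t : ℝ => (q.1, t)) ((0, 1) : ℝ × ℝ) q.2 :=
      (hasDerivAt_const _ _).prodMk (hasDerivAt_id q.2)
    exact ((hrd q hq).comp_hasDerivAt q.2 h1).deriv.symm
  have hfI : ContDiffOn ℝ ∞ f (Ioo (-1) 1) := hg.f_smooth.mono Ioo_subset_Icc_self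
  refine eq_one_sub_sq_of_deriv_deriv hg.f_smooth.continuousOn
    (fun x hx => (hfI.contDiffAt (isOpen_Ioo.mem_nhds hx)).differentiableAt (by simp))
    (fun x hx => deriv_deriv_eq_of_isometric hr hfI hg.f_pos (fun q _ => ?_) (fun q hq => ?_)
      (fun q hq => ?_) (fun q hq => ?_) hx) hg.f_left hg.f_right
  · have h1 := mem_sphere_zero_iff_norm.1 (F (coordPoint Φ q.1 q.2)).2
    rw [real_inner_self_eq_norm_sq]
    simp only [hrdef, h1, one_pow]
  · rw [hX q hq, ← roundInner_mfderiv, hF]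
    exact hg.metric_xx _ hq.1 _
  · rw [hX q hq, hT q hq, ← roundInner_mfderiv, hF]
    exact hg.metric_xtheta _ hq.1 _
  · rw [hT q hq, ← roundInner_mfderiv, hF]
    exact hg.metric_thetatheta _ hq.1 _

/-- The Gram matrix is diagonal with entries `1 / f` and `f`, so the coordinate vectors are
independent, and the tangent space has dimension two. -/
lemma exists_eq_coordVec {x : ℝ} (hx : x ∈ Ioo (-1 : ℝ) 1) (θ : ℝ)
    (v : TangentSpace (𝓡 2) (coordPoint Φ x θ)) :
    ∃ a b : ℝ, a • coordVecX (coordPoint Φ) x θ + b • coordVecTheta (coordPoint Φ) x θ = v := by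
  have hE := hg.metric_xx x hx θ
  have hF := hg.metric_xtheta x hx θ
  have hG := hg.metric_thetatheta x hx θ
  rw [gramE] at hE
  rw [gramF] at hF
  rw [gramG] at hG
  have hfx := (hg.f_pos x hx).ne'
  have hli : LinearIndependent ℝ
      ![coordVecX (coordPoint Φ) x θ, coordVecTheta (coordPoint Φ) x θ] := by
    rw [LinearIndependent.pair_iff]
    intro s t hst
    have h1 := congrArg (g.inner (coordPoint Φ x θ) (coordVecX (coordPoint Φ) x θ)) hst
    have h2 := congrArg (g.inner (coordPoint Φ x θ) (coordVecTheta (coordPoint Φ) x θ)) hst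
    rw [map_add, map_smul, map_smul, hE, hF, map_zero] at h1
    rw [map_add, map_smul, map_smul, hG, g.symm, hF, map_zero] at h2
    simp only [smul_eq_mul, mul_zero, add_zero, zero_add] at h1 h2
    exact ⟨by simpa [hfx] using h1, by simpa [hfx] using h2⟩
  have hspan := hli.span_eq_top_of_card_eq_finrank (by
    change Fintype.card (Fin 2) = Module.finrank ℝ (EuclideanSpace ℝ (Fin 2))
    simp)
  have hv : v ∈ Submodule.span ℝ
      (Set.range ![coordVecX (coordPoint Φ) x θ, coordVecTheta (coordPoint Φ) x θ]) :=
    hspan ▸ Submodule.mem_top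
  rw [Matrix.range_cons, Matrix.range_cons, Matrix.range_empty, union_empty] at hv
  exact Submodule.mem_span_pair.1 hv

/-- The round metric in cylinder coordinates. -/
lemma inner_ambientDeriv_of_mem_Ioo (hf : ∀ x ∈ Icc (-1 : ℝ) 1, f x = 1 - x ^ 2) {x : ℝ}
    (hx : x ∈ Ioo (-1 : ℝ) 1) (θ : ℝ) (v : TangentSpace (𝓡 2) (coordPoint Φ x θ)) :
    inner ℝ (ambientDeriv Φ (coordPoint Φ x θ) v) (ambientDeriv Φ (coordPoint Φ x θ) v) =
      g.inner (coordPoint Φ x θ) v v := by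
  obtain ⟨a, b, rfl⟩ := hg.exists_eq_coordVec hx θ v
  have hE := hg.metric_xx x hx θ
  have hF := hg.metric_xtheta x hx θ
  have hG := hg.metric_thetatheta x hx θ
  rw [gramE] at hE
  rw [gramF] at hF
  rw [gramG] at hG
  have hd := one_sub_sq_pos hx
  have hs := (sqrt_pos.2 hd).ne'
  have hs2 := Real.sq_sqrt hd.le
  have h1 : ∀ s ∈ Icc (-1 : ℝ) 1, ∀ t, (Φ (coordPoint Φ s t) : EuclideanSpace ℝ (Fin 3)) =
      !₂[√(1 - s ^ 2) * cos t, √(1 - s ^ 2) * sin t, s] := fun s hs t => by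
    rw [coordPoint, Diffeomorph.apply_symm_apply]
    simp only [cylinderPoint, projIcc_of_mem _ hs]
  have hX : ambientDeriv Φ (coordPoint Φ x θ) (coordVecX (coordPoint Φ) x θ) =
      deriv (fun s => !₂[√(1 - s ^ 2) * cos θ, √(1 - s ^ 2) * sin θ, s]) x := by
    rw [ambientDeriv_coordVecX Φ.contMDiff hx]
    refine Filter.EventuallyEq.deriv_eq ?_
    filter_upwards [Ioo_mem_nhds hx.1 hx.2] with s hs using h1 s (Ioo_subset_Icc_self hs) θ
  have hT : ambientDeriv Φ (coordPoint Φ x θ) (coordVecTheta (coordPoint Φ) x θ) =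
      deriv (fun t => !₂[√(1 - x ^ 2) * cos t, √(1 - x ^ 2) * sin t, x]) θ := by
    rw [ambientDeriv_coordVecTheta Φ.contMDiff hx]
    simp only [h1 x (Ioo_subset_Icc_self hx)]
  have hsq : HasDerivAt (fun s : ℝ => √(1 - s ^ 2)) (-(x / √(1 - x ^ 2))) x := by
    have h2 : HasDerivAt (fun s : ℝ => 1 - s ^ 2) (-(2 * x)) x := by
      simpa using (hasDerivAt_pow 2 x).const_sub 1
    refine (h2.sqrt hd.ne').congr_deriv ?_
    field_simp
  have hXd := And.intro (hsq.mul_const (cos θ)) (hsq.mul_const (sin θ))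
  have hTd := And.intro ((hasDerivAt_cos θ).const_mul √(1 - x ^ 2))
    ((hasDerivAt_sin θ).const_mul √(1 - x ^ 2))
  have iXX := inner_velocity_eq hXd.1 hXd.2 (hasDerivAt_id' x) hXd.1 hXd.2 (hasDerivAt_id' x)
  have iXT := inner_velocity_eq hXd.1 hXd.2 (hasDerivAt_id' x) hTd.1 hTd.2 (hasDerivAt_const θ x)
  have iTT := inner_velocity_eq hTd.1 hTd.2 (hasDerivAt_const θ x) hTd.1 hTd.2
    (hasDerivAt_const θ x)
  rw [← hX, ← hT] at iXT
  rw [← hX] at iXX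
  rw [← hT] at iTT
  simp only [map_add, map_smul, _root_.add_apply, _root_.smul_apply,
    smul_eq_mul, inner_add_left, inner_add_right, real_inner_smul_left, real_inner_smul_right]
  rw [g.symm _ (coordVecTheta (coordPoint Φ) x θ) (coordVecX (coordPoint Φ) x θ), hE, hF, hG,
    real_inner_comm (ambientDeriv Φ (coordPoint Φ x θ) (coordVecX (coordPoint Φ) x θ))
      (ambientDeriv Φ (coordPoint Φ x θ) (coordVecTheta (coordPoint Φ) x θ)), iXX, iXT, iTT,
    hf x (Ioo_subset_Icc_self hx)]
  have hc := sin_sq_add_cos_sq θ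
  have k1 : -(x / √(1 - x ^ 2)) * cos θ * (-(x / √(1 - x ^ 2)) * cos θ) +
      -(x / √(1 - x ^ 2)) * sin θ * (-(x / √(1 - x ^ 2)) * sin θ) + 1 * 1 = 1 / (1 - x ^ 2) := by
    have k3 : (x / √(1 - x ^ 2)) ^ 2 = x ^ 2 / (1 - x ^ 2) := by rw [div_pow, hs2]
    have k4 : 1 / (1 - x ^ 2) = x ^ 2 / (1 - x ^ 2) + 1 := by
      have := hd.ne'
      field_simp
      ring
    rw [k4, ← k3]
    linear_combination (x / √(1 - x ^ 2)) ^ 2 * hc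
  rw [k1]
  linear_combination b ^ 2 * (√(1 - x ^ 2) ^ 2 * hc + hs2)

end IsMomentumForm

end

/-! ### Isometry at the poles -/

lemma inner_mfderiv_coe_S2 (q : S2) (w : TangentSpace (𝓡 2) q) :
    inner ℝ (q : EuclideanSpace ℝ (Fin 3)) (mfderiv (𝓡 2) 𝓘(ℝ, EuclideanSpace ℝ (Fin 3))
      (fun q : S2 => (q : EuclideanSpace ℝ (Fin 3))) q w) = 0 := by
  have := fact_finrank_three
  have h1 : mvfderiv (𝓡 2) (fun q : S2 => (q : EuclideanSpace ℝ (Fin 3))) q w ∈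
      (ℝ ∙ (q : EuclideanSpace ℝ (Fin 3)))ᗮ := by
    rw [← range_mvfderiv_subtypeVal (n := 2) q]
    exact ⟨w, rfl⟩
  exact Submodule.mem_orthogonal_singleton_iff_inner_right.1 h1

lemma norm_great_circle {q e : EuclideanSpace ℝ (Fin 3)} (hq : ‖q‖ = 1) (he : ‖e‖ = 1)
    (hqe : inner ℝ q e = (0 : ℝ)) (t : ℝ) : ‖cos t • q + sin t • e‖ = 1 := by
  have h : ‖cos t • q + sin t • e‖ ^ 2 = 1 := by
    rw [norm_add_sq_real, norm_smul, norm_smul, real_inner_smul_left, real_inner_smul_right, hq, he,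
      hqe]
    simp
  exact (sq_eq_sq₀ (norm_nonneg _) zero_le_one).mp (by rw [h, one_pow])

section

variable {M : Type*} [TopologicalSpace M] [ChartedSpace (EuclideanSpace ℝ (Fin 2)) M]
  {Φ : M ≃ₘ⟮𝓡 2, 𝓡 2⟯ S2}

lemma inner_ambientDeriv (F : M → S2) (q : M) (v : TangentSpace (𝓡 2) q) :
    inner ℝ (F q : EuclideanSpace ℝ (Fin 3)) (ambientDeriv F q v) = (0 : ℝ) :=
  inner_mfderiv_coe_S2 (F q) _

lemma ambientDeriv_injective (Φ : M ≃ₘ⟮𝓡 2, 𝓡 2⟯ S2) (q : M) :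
    Function.Injective (ambientDeriv Φ q) := by
  have h1 : Function.Injective (mfderiv (𝓡 2) (𝓡 2) Φ q) := by
    rw [← Φ.mfderivToContinuousLinearEquiv_coe (by simp)]
    exact (Φ.mfderivToContinuousLinearEquiv (by simp) q).injective
  exact (mfderiv_coe_S2_injective (Φ q)).comp h1

variable [IsManifold (𝓡 2) ∞ M] {g : SurfaceMetric M}

/-- A metric which is round off the poles is round at the poles. -/
lemma inner_ambientDeriv_of_pole
    (hg : ∀ q : M, height Φ q ∈ Ioo (-1 : ℝ) 1 → ∀ v : TangentSpace (𝓡 2) q,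
      inner ℝ (ambientDeriv Φ q v) (ambientDeriv Φ q v) = g.inner q v v)
    {q₀ : M} (hq₀ : height Φ q₀ ^ 2 = 1) (v : TangentSpace (𝓡 2) q₀) :
    inner ℝ (ambientDeriv Φ q₀ v) (ambientDeriv Φ q₀ v) = g.inner q₀ v v := by
  by_cases hv : v = 0
  · simp [hv]
  set ξ := ambientDeriv Φ q₀ v with hξ
  have hξ0 : ξ ≠ 0 := fun h => hv (ambientDeriv_injective Φ q₀ (by rw [← hξ, h, map_zero]))
  have hξn := norm_ne_zero_iff.2 hξ0
  set e := ‖ξ‖⁻¹ • ξ with he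
  have hξe : ξ = ‖ξ‖ • e := by rw [he, smul_smul, mul_inv_cancel₀ hξn, one_smul]
  have hen : ‖e‖ = 1 := by rw [he, norm_smul, norm_inv, norm_norm, inv_mul_cancel₀ hξn]
  set Q : EuclideanSpace ℝ (Fin 3) := (Φ q₀ : EuclideanSpace ℝ (Fin 3)) with hQ
  have hQn : ‖Q‖ = 1 := mem_sphere_zero_iff_norm.1 (Φ q₀).2
  have hQe : inner ℝ Q e = (0 : ℝ) := by
    rw [he, real_inner_smul_right, inner_ambientDeriv, mul_zero]
  have hQ2 : Q 2 ^ 2 = 1 := hq₀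
  have hQ01 : Q 0 = 0 ∧ Q 1 = 0 := by
    have h1 : ‖Q‖ ^ 2 = 1 := by rw [hQn, one_pow]
    rw [EuclideanSpace.norm_sq_eq] at h1
    simp only [Fin.sum_univ_three, Real.norm_eq_abs, sq_abs] at h1
    constructor <;> nlinarith [sq_nonneg (Q 0), sq_nonneg (Q 1)]
  have he2 : e 2 = 0 := by
    rw [PiLp.inner_apply, Fin.sum_univ_three, hQ01.1, hQ01.2] at hQe
    have : Q 2 ≠ 0 := fun h => by rw [h] at hQ2; norm_num at hQ2
    simpa [this] using hQe
  -- The unit-speed great circle leaving the pole in the direction `e`. For `0 < t < π` it avoids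
  -- both poles, because `e` is horizontal, so its preimage has `g`-speed one there, and by
  -- continuity also at `t = 0`.
  set γ : ℝ → S2 := fun t => ⟨cos t • Q + sin t • e,
    mem_sphere_zero_iff_norm.2 (norm_great_circle hQn hen hQe t)⟩ with hγdef
  have hγ : ContMDiff 𝓘(ℝ, ℝ) (𝓡 2) ∞ γ :=
    contMDiff_codRestrict_S2 (F := fun t : ℝ => cos t • Q + sin t • e) (by fun_prop)
      fun t => mem_sphere_zero_iff_norm.2 (norm_great_circle hQn hen hQe t)
  set η : ℝ → M := fun t => Φ.symm (γ t) with hηdef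
  have hη : ContMDiff 𝓘(ℝ, ℝ) (𝓡 2) ∞ η := Φ.symm.contMDiff.comp hγ
  have hΦη : ∀ t, (Φ (η t) : EuclideanSpace ℝ (Fin 3)) = cos t • Q + sin t • e := fun t => by
    simp only [hηdef, Diffeomorph.apply_symm_apply, hγdef]
  have hvel : ∀ t, ambientDeriv Φ (η t) (mfderiv 𝓘(ℝ, ℝ) (𝓡 2) η t (1 : ℝ)) =
      -sin t • Q + cos t • e := fun t => by
    rw [ambientDeriv_velocity Φ.contMDiff ((hη t).mdifferentiableAt (by simp))]
    simp only [hΦη]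
    exact (((hasDerivAt_cos t).smul_const Q).add ((hasDerivAt_sin t).smul_const e)).deriv
  have hunit : ∀ t, inner ℝ (-sin t • Q + cos t • e) (-sin t • Q + cos t • e) = (1 : ℝ) := fun t => by
    rw [real_inner_self_eq_norm_sq, norm_add_sq_real, norm_smul, norm_smul, real_inner_smul_left,
      real_inner_smul_right, hQn, hen, hQe]
    simp
  have hη0 : η 0 = q₀ := by
    have : γ 0 = Φ q₀ := Subtype.ext (by simp [hγdef, hQ])
    simp only [hηdef, this, Diffeomorph.symm_apply_apply]
  have hpole : g.inner (η 0) (mfderiv 𝓘(ℝ, ℝ) (𝓡 2) η 0 (1 : ℝ))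
      (mfderiv 𝓘(ℝ, ℝ) (𝓡 2) η 0 (1 : ℝ)) = 1 := by
    refine tendsto_nhds_unique
      (((continuous_inner_velocity g hη).tendsto 0).mono_left (nhdsWithin_le_nhds (s := Ioi 0)))
      (tendsto_const_nhds.congr' ?_)
    filter_upwards [Ioo_mem_nhdsGT pi_pos] with t ht
    rw [← hg (η t) ?_, hvel, hunit]
    have h1 : height Φ (η t) = cos t * Q 2 := by
      simp only [height, hΦη, PiLp.add_apply, PiLp.smul_apply, he2, smul_eq_mul, mul_zero, add_zero]
    have h2 : 0 < sin t := sin_pos_of_pos_of_lt_pi ht.1 ht.2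
    rw [h1, mem_Ioo, ← abs_lt, ← sq_lt_one_iff_abs_lt_one, mul_pow, hQ2]
    nlinarith [sin_sq_add_cos_sq t]
  -- Stated for a variable point because `v` lives in the tangent space at `q₀`, the velocity in
  -- that at `η 0`; substituting `η 0` for the point identifies the two.
  have hfinal : ∀ q : M, η 0 = q → ∀ v : TangentSpace (𝓡 2) q, ambientDeriv Φ q v = ‖ξ‖ • e →
      g.inner q v v = ‖ξ‖ ^ 2 := by
    rintro q rfl v hv
    have h1 : v = ‖ξ‖ • mfderiv 𝓘(ℝ, ℝ) (𝓡 2) η 0 (1 : ℝ) := by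
      apply ambientDeriv_injective Φ
      rw [hv, map_smul, hvel]
      simp
    have h2 : ∀ (V : TangentSpace (𝓡 2) (η 0)) (c : ℝ),
        g.inner (η 0) (c • V) (c • V) = c * (c * g.inner (η 0) V V) := fun V c => by
      rw [map_smul, map_smul, _root_.smul_apply, smul_eq_mul, smul_eq_mul]
    rw [h1, h2, hpole, mul_one, sq]
  rw [hfinal q₀ hη0 v (by rw [← hξ, ← hξe]), real_inner_self_eq_norm_sq]

variable [MulAction Circle M] {f : ℝ → ℝ}

namespace IsMomentumForm

variable (hg : IsMomentumForm g f Φ)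

include hg

/-- The profile `1 - x²` gives the round sphere. -/
theorem isometric_of_profile_eq (hf : ∀ x ∈ Icc (-1 : ℝ) 1, f x = 1 - x ^ 2) :
    IsIsometricToRoundSphere g := by
  have hint : ∀ q : M, height Φ q ∈ Ioo (-1 : ℝ) 1 → ∀ v : TangentSpace (𝓡 2) q,
      inner ℝ (ambientDeriv Φ q v) (ambientDeriv Φ q v) = g.inner q v v := fun q hq v => by
    obtain ⟨x, hx, θ, rfl⟩ := exists_eq_coordPoint Φ q
    rw [height_coordPoint Φ hx] at hq
    exact hg.inner_ambientDeriv_of_mem_Ioo hf hq θ v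
  have hquad : ∀ (q : M) (v : TangentSpace (𝓡 2) q),
      inner ℝ (ambientDeriv Φ q v) (ambientDeriv Φ q v) = g.inner q v v := fun q v => by
    obtain ⟨x, hx, θ, hq⟩ := exists_eq_coordPoint Φ q
    have hh : height Φ q = x := by rw [hq, height_coordPoint Φ hx]
    by_cases hx' : x ∈ Ioo (-1 : ℝ) 1
    · exact hint q (hh ▸ hx') v
    · refine inner_ambientDeriv_of_pole hint ?_ v
      rw [hh]
      rcases hx.1.eq_or_lt with h | h
      · rw [← h]; norm_num
      · rw [le_antisymm hx.2 (not_lt.1 fun h' => hx' ⟨h, h'⟩), one_pow]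
  -- The isometry is `Φ` itself; equality of the quadratic forms is polarized.
  refine ⟨Φ, fun q v w => ?_⟩
  rw [roundInner_mfderiv]
  have h1 := hquad q (v + w)
  have h2 := hquad q v
  have h3 := hquad q w
  simp only [map_add, _root_.add_apply, inner_add_left, inner_add_right] at h1
  rw [g.symm q w v, real_inner_comm (ambientDeriv Φ q v) (ambientDeriv Φ q w)] at h1
  linarith

end IsMomentumForm

end

/-! ### The main theorem -/

theorem proposition4p1 {M : Type*} [TopologicalSpace M]
    [ChartedSpace (EuclideanSpace ℝ (Fin 2)) M] [IsManifold (𝓡 2) ∞ M] [MulAction Circle M]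
    (g : SurfaceMetric M) (f : ℝ → ℝ) (Φ : M ≃ₘ⟮𝓡 2, 𝓡 2⟯ S2) (hg : IsMomentumForm g f Φ) :
    ∃ lam : ℝ, IsFirstInvariantEigenvalue g Φ lam ∧
      lam ≤ 3 / 2 * (∫ x in (-1 : ℝ)..1, f x) ∧
      (lam = 3 / 2 * (∫ x in (-1 : ℝ)..1, f x) ↔ IsIsometricToRoundSphere g) ∧
      (lam = 3 / 2 * (∫ x in (-1 : ℝ)..1, f x) ↔ ∀ x ∈ Icc (-1 : ℝ) 1, f x = 1 - x ^ 2) := by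
  obtain ⟨p, hp, hpos, hps, hp1, hfp⟩ := exists_profile_factor hg.f_smooth hg.f_pos hg.f_left
    hg.f_right hg.f_deriv_left hg.f_deriv_right
  obtain ⟨l, z, dw, hl, hz, hzpos, hsol⟩ := exists_positive_eigenfunction hp hpos
  have hw : IsPositiveSolution p l (fun x => (1 - x ^ 2) * z x) dw :=
    { sol := hsol
      continuousOn := by fun_prop
      pos := fun x hx => mul_pos (one_sub_sq_pos hx) (hzpos x hx)
      left := by simp
      right := by simp }
  obtain ⟨y, hy, hdy⟩ := hsol.contDiffOn hps hpos hz
  -- The eigenfunction is recovered from `w' = -l U`, with `y` the version of `w'` smooth up to the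
  -- end points; the claim is `U' = w / f`.
  have hdU : ∀ x ∈ Ioo (-1 : ℝ) 1,
      HasDerivAt (fun x => -(y x / l)) ((1 - x ^ 2) * z x / ((1 - x ^ 2) * p x)) x := fun x hx => by
    have h1 : HasDerivAt y (-(l * ((1 - x ^ 2) * z x) / ((1 - x ^ 2) * p x))) x := by
      refine (hsol x hx).2.congr_of_eventuallyEq ?_
      filter_upwards [Ioo_mem_nhds hx.1 hx.2] with t ht using (hdy t ht).symm
    refine (h1.div_const l).neg.congr_deriv ?_
    rw [neg_div, neg_neg, mul_div_assoc, mul_div_cancel_left₀ _ hl.ne']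
  have hint : ∫ x in (-1 : ℝ)..1, f x = ∫ x in (-1 : ℝ)..1, (1 - x ^ 2) * p x := by
    refine intervalIntegral.integral_congr fun x hx => ?_
    rw [uIcc_of_le (by norm_num)] at hx
    exact hfp x hx
  obtain ⟨hle, heq⟩ := hw.le_integral hp hpos hl.le
  have hprofile : l = 3 / 2 * (∫ x in (-1 : ℝ)..1, f x) ↔
      ∀ x ∈ Icc (-1 : ℝ) 1, f x = 1 - x ^ 2 := by
    constructor
    · intro h
      obtain ⟨c, hc⟩ := heq (by rw [← hint]; exact h)
      have h1 : EqOn p (fun _ => c) (Icc (-1) 1) := EqOn.of_subset_closure hc hp.continuousOn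
        continuousOn_const Ioo_subset_Icc_self Icc_subset_closure_Ioo
      have h2 : c = 1 := by rw [← hp1]; exact (h1 (by simp)).symm
      intro x hx
      rw [hfp x hx, h1 hx, h2, mul_one]
    · intro h
      have hone : ∀ x ∈ Ioo (-1 : ℝ) 1, p x = 1 := fun x hx => by
        have h1 := hfp x (Ioo_subset_Icc_self hx)
        rw [h x (Ioo_subset_Icc_self hx)] at h1
        exact mul_left_cancel₀ (one_sub_sq_pos hx).ne' (by rw [← h1, mul_one])
      have hA : ∫ x in (-1 : ℝ)..1, f x = 4 / 3 := by
        rw [intervalIntegral.integral_congr (g := fun x => 1 - x ^ 2) fun x hx => h x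
          (by rwa [uIcc_of_le (by norm_num)] at hx),
          intervalIntegral.integral_sub (by simp) (by simp), integral_pow]
        norm_num
      rw [← hint, hA] at hle
      rw [hA]
      refine le_antisymm hle (not_lt.1 fun hlt => ?_)
      -- For the round profile the bound reads `l ≤ 2`. Since `1 - x²` is itself a positive solution
      -- with parameter two, comparison rules out `l < 2`.
      have h2 : IsPositiveSolution p 2 (fun x => 1 - x ^ 2) (fun x => -2 * x) :=
        { sol := fun x hx => by
            constructor
            · exact ((hasDerivAt_pow 2 x).const_sub 1).congr_deriv (by simp)
            · refine ((hasDerivAt_id' x).const_mul (-2)).congr_deriv ?_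
              simp only [hone x hx, mul_one]
              rw [mul_div_cancel_right₀ _ (one_sub_sq_pos hx).ne']
          continuousOn := by fun_prop
          pos := fun x hx => one_sub_sq_pos hx
          left := by simp
          right := by simp }
      obtain ⟨C, hC⟩ := (isCompact_Icc (a := (-1 : ℝ)) (b := 1)).exists_bound_of_continuousOn
        hz.continuousOn
      obtain ⟨C', hC'⟩ := (isCompact_Icc (a := (-1 : ℝ)) (b := 1)).exists_bound_of_continuousOn
        hy.continuousOn
      have h3 := h2.eq_zero_of_lt hpos (by norm_num) (by linarith) hsol (C := C) (C' := C')
        (fun x hx => by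
          rw [abs_mul, abs_of_pos (one_sub_sq_pos hx), mul_comm]
          exact mul_le_mul_of_nonneg_right (hC x (Ioo_subset_Icc_self hx)) (one_sub_sq_pos hx).le)
        (fun x hx => by rw [hdy x hx]; exact hC' x (Ioo_subset_Icc_self hx))
        (x := 0) (by norm_num)
      exact (hw.pos 0 (by norm_num)).ne' h3
  refine ⟨l, ⟨⟨hl.ne', ?_⟩, fun m hm => ?_⟩, by rw [hint]; exact hle,
    hprofile.trans ⟨hg.isometric_of_profile_eq, hg.profile_eq_of_isometric⟩, hprofile⟩
  · refine hg.isInvariantEigenvalue (U := fun x => -(y x / l)) (hy.div_const l).neg ?_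
      fun x hx => ?_
    · by_contra! hall
      have h0 : (0 : ℝ) ∈ Ioo (-1 : ℝ) 1 := by norm_num
      have h1 : (fun x => -(y x / l)) =ᶠ[𝓝 0] fun _ => 0 := by
        filter_upwards [Ioo_mem_nhds h0.1 h0.2] with t ht using hall t ht
      have h2 := (hdU 0 h0).unique ((hasDerivAt_const 0 (0 : ℝ)).congr_of_eventuallyEq h1)
      exact (div_pos (hw.pos 0 h0) (mul_pos (one_sub_sq_pos h0) (hpos 0))).ne' h2
    · have h1 : (fun s => f s * deriv (fun x => -(y x / l)) s) =ᶠ[𝓝 x]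
          fun x => (1 - x ^ 2) * z x := by
        filter_upwards [Ioo_mem_nhds hx.1 hx.2] with t ht
        rw [(hdU t ht).deriv, hfp t (Ioo_subset_Icc_self ht),
          mul_div_cancel₀ _ (mul_pos (one_sub_sq_pos ht) (hpos t)).ne']
      rw [h1.deriv_eq, (hsol x hx).1.deriv, hdy x hx, mul_neg, neg_neg, mul_div_cancel₀ _ hl.ne']
  -- Comparison excludes every nonzero eigenvalue below `l`, negative ones included, so no separate
  -- proof that the spectrum is nonnegative is needed.
  · refine not_lt.1 fun hlt => ?_
    obtain ⟨φ, dφ, C, hφ, hC, hC', x, hx, hne⟩ :=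
      hg.exists_dirichlet_solution hp hpos hps hfp hm.1 hm.2
    exact hne (hw.eq_zero_of_lt hpos hl.le hlt hφ hC hC' hx)
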